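/- Let $p$ be an odd prime and $n\ge 0$ an integer. Homomorphisms of pro-$p$-groups are continuous and subgroups are closed. **Notation.** Let $F_n$ be the free pro-$p$-group on $n$ generators, and let $d(G)$ denote the minimal number of (topological) generators of a pro-$p$-group $G$. A subgroup of $F_n$ is *characteristic* if it is invariant under all (continuous) automorphisms of $F_n$. For a characteristic subgroup $E\subset F_n$ and a pro-$p$-group $G$ with $d(G)\le n$, put $E(G):=\varphi(E)$ for any surjective homomorphism $\varphi\colon F_n\to G$; this normal subgroup does not depend on $\varphi$. For a normal subgroup $N$ of $F_n$ let $N^*$ be the closed subgroup generated by all $a^p$ with $a\in N$ and all commutators $[f,a]$ with $f\in F_n$, $a\in N$. If $d(G)=n$ and $E(G)=1$, and $G\cong F_n/N$, then $E\subset N$, and we put $r_E(G):=\dim_{\mathbb F_p}(N/EN^*)$; this is independent of the presentation. A *$\sigma$-pro-$p$-group* is a pro-$p$-group with an action of a group $\{1,\sigma\}$ of order $2$ by continuous automorphisms; it is called a *$\sigma$-$p$-group* if it is finite. An element $a$ is *odd* if ${}^\sigma a=a^{-1}$. A *weak Schur $\sigma$-group* is a $\sigma$-pro-$p$-group $G$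 such that $\dim_{\mathbb F_p}H^2(G,\mathbb F_p)\le\dim_{\mathbb F_p}H^1(G,\mathbb F_p)<\infty$ (continuous cohomology, trivial action on $\mathbb F_p$) and $\sigma$ acts by $-1$ on both spaces. For an open proper characteristic subgroup $E$ of $F_n$, a finite $p$-group $H$ is called a *Schur $E$-quotient* if there exists a weak Schur $\sigma$-group $G$ with $d(G)=n$ and $G/E(G)\cong H$ (as groups, without regard to $\sigma$). **Proposition.** Let $E\subset D$ be open proper characteristic subgroups of $F_n$. Let $H$ be a Schur $D$-quotient with $r_D(H)=n$, and let $K$ be a finite $p$-group with $d(K)=n$ and $K/D(K)\cong H$. Then $K$ is a Schur $E$-quotient if and only if the following conditions all hold: (a) $E(K)=1$; (b) $K$ possesses the structure of a $\sigma$-$p$-group that is generated by odd elements; (c) $r_E(K)=n$. -/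

import Mathlib

/-! ### Pro-`p`-groups and the number of generators -/

/-- A topological group is a pro-`p`-group if it is profinite and every open normal subgroup has
`p`-power index. -/
structure IsProP (p : ℕ) (G : Type*) [Group G] [TopologicalSpace G] [IsTopologicalGroup G] :
    Prop where
  compact : CompactSpace G
  t2 : T2Space G
  totallyDisconnected : TotallyDisconnectedSpace G
  index_eq_pow : ∀ U : Subgroup G, U.Normal → IsOpen (U : Set G) → ∃ k : ℕ, U.index = p ^ k

/-- The subset `S` generates `G` topologically. -/
def TopologicallyGenerates {G : Type*} [Group G] [TopologicalSpace G] [IsTopologicalGroup G]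
    (S : Set G) : Prop :=
  (Subgroup.closure S).topologicalClosure = ⊤

/-- `d(G) = n`: the minimal number of topological generators of `G` is (finite and) equal
to `n`. -/
def HasMinGenerators (G : Type*) [Group G] [TopologicalSpace G] [IsTopologicalGroup G]
    (n : ℕ) : Prop :=
  IsLeast {k : ℕ | ∃ x : Fin k → G, TopologicallyGenerates (Set.range x)} n

/-! ### The free pro-`p`-group `F_n` -/

/-- The normal subgroups of `p`-power index in an abstract group. -/
structure PPowerIndexNormal (p : ℕ) (Γ : Type*) [Group Γ] where
  toSubgroup : Subgroup Γ
  normal : toSubgroup.Normal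
  index_eq_pow : ∃ k : ℕ, toSubgroup.index = p ^ k

attribute [instance] PPowerIndexNormal.normal

/-- The finite `p`-group `Γ ⧸ N`, with the discrete topology. -/
def PPowerIndexNormal.Quot {p : ℕ} {Γ : Type*} [Group Γ] (N : PPowerIndexNormal p Γ) : Type _ :=
  Γ ⧸ N.toSubgroup

instance {p : ℕ} {Γ : Type*} [Group Γ] (N : PPowerIndexNormal p Γ) : Group N.Quot :=
  inferInstanceAs (Group (Γ ⧸ N.toSubgroup))

instance {p : ℕ} {Γ : Type*} [Group Γ] (N : PPowerIndexNormal p Γ) : TopologicalSpace N.Quot := ⊥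

instance {p : ℕ} {Γ : Type*} [Group Γ] (N : PPowerIndexNormal p Γ) : DiscreteTopology N.Quot := ⟨rfl⟩

/-- The transition map `Γ ⧸ N → Γ ⧸ M` for `N ≤ M`. -/
def PPowerIndexNormal.transition {p : ℕ} {Γ : Type*} [Group Γ] {N M : PPowerIndexNormal p Γ}
    (h : N.toSubgroup ≤ M.toSubgroup) : N.Quot →* M.Quot :=
  QuotientGroup.map N.toSubgroup M.toSubgroup (MonoidHom.id Γ) h

/-- The pro-`p` completion of an abstract group: the inverse limit of its quotients of `p`-power
order, as a subgroup of their product. -/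
def proPCompletion (p : ℕ) (Γ : Type*) [Group Γ] :
    Subgroup (∀ N : PPowerIndexNormal p Γ, N.Quot) where
  carrier := {x | ∀ (N M : PPowerIndexNormal p Γ) (h : N.toSubgroup ≤ M.toSubgroup),
    PPowerIndexNormal.transition h (x N) = x M}
  mul_mem' := by
    intro x y hx hy N M h
    simp only [Pi.mul_apply, map_mul, hx N M h, hy N M h]
  one_mem' := by
    intro N M h
    simp only [Pi.one_apply, map_one]
  inv_mem' := by
    intro x hx N M h
    simp only [Pi.inv_apply, map_inv, hx N M h]

/-- The free pro-`p`-group `F_n` on `n` generators, i.e. the pro-`p` completion of the abstract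
free group on `n` generators. -/
abbrev FreeProP (p n : ℕ) : Type := proPCompletion p (FreeGroup (Fin n))

/-! ### Characteristic subgroups of `F_n` and the subgroups `E(G)` -/

/-- A subgroup of a topological group is (topologically) characteristic if it is invariant under
all continuous automorphisms. -/
class IsTopCharacteristic {G : Type*} [Group G] [TopologicalSpace G] (E : Subgroup G) : Prop where
  map_eq : ∀ α : G ≃ₜ* G, E.map (α : G →* G) = E

instance IsTopCharacteristic.normal {G : Type*} [Group G] [TopologicalSpace G]
    [IsTopologicalGroup G] (E : Subgroup G) [IsTopCharacteristic E] : E.Normal where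
  conj_mem x hx g := by
    let α : G ≃ₜ* G :=
      { MulAut.conj g with
        continuous_toFun := by
          change Continuous fun y => g * y * g⁻¹
          fun_prop
        continuous_invFun := by
          change Continuous fun y => g⁻¹ * y * g
          fun_prop }
    rw [← IsTopCharacteristic.map_eq (E := E) α]
    exact ⟨x, hx, rfl⟩

open Classical in
/-- A chosen surjective continuous homomorphism `φ : F_n → G` if there is one, i.e. for a
pro-`p`-group `G` if `d(G) ≤ n` (otherwise the trivial homomorphism, a value of no interest).
It is unique up to automorphisms of `F_n`. -/
noncomputable def presentation (p n : ℕ) (G : Type*) [Group G] [TopologicalSpace G]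
    [IsTopologicalGroup G] : FreeProP p n →ₜ* G :=
  if h : ∃ φ : FreeProP p n →ₜ* G, Function.Surjective φ then h.choose else 1

/-- The subgroup `E(G) = φ(E)` of `G`, for a surjective homomorphism `φ : F_n → G`. -/
noncomputable def canonicalSubgroup {p n : ℕ} (E : Subgroup (FreeProP p n)) (G : Type*) [Group G]
    [TopologicalSpace G] [IsTopologicalGroup G] : Subgroup G :=
  E.map (presentation p n G : FreeProP p n →* G)

instance {p n : ℕ} (E : Subgroup (FreeProP p n)) [E.Normal] (G : Type*) [Group G]
    [TopologicalSpace G] [IsTopologicalGroup G] : (canonicalSubgroup E G).Normal := by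
  by_cases h : ∃ φ : FreeProP p n →ₜ* G, Function.Surjective φ
  · have hs : Function.Surjective (presentation p n G) := by
      rw [presentation, dif_pos h]
      exact h.choose_spec
    exact Subgroup.Normal.map inferInstance _ hs
  · have : canonicalSubgroup E G = ⊥ := by
      rw [canonicalSubgroup, presentation, dif_neg h, eq_bot_iff]
      rintro _ ⟨x, -, rfl⟩
      rfl
    rw [this]
    infer_instance

/-! ### The minimal number of relations `r_E(G)` -/

/-- `N^*`, the closed subgroup of `F` generated by all `a ^ p` with `a ∈ N` and all commutators
of elements of `F` with elements of `N`. -/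
def relativeFrattini (p : ℕ) {F : Type*} [Group F] [TopologicalSpace F] [IsTopologicalGroup F]
    (N : Subgroup F) : Subgroup F :=
  (Subgroup.closure {x | ∃ a ∈ N, x = a ^ p} ⊔ ⁅(⊤ : Subgroup F), N⁆).topologicalClosure

instance (p : ℕ) {F : Type*} [Group F] [TopologicalSpace F] [IsTopologicalGroup F]
    (N : Subgroup F) [hN : N.Normal] : (relativeFrattini p N).Normal := by
  have : (Subgroup.closure {x | ∃ a ∈ N, x = a ^ p}).Normal := by
    refine ⟨fun x hx g => ?_⟩
    induction hx using Subgroup.closure_induction with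
    | mem x hx =>
      obtain ⟨a, ha, rfl⟩ := hx
      exact Subgroup.subset_closure ⟨g * a * g⁻¹, hN.conj_mem a ha g, by rw [conj_pow]⟩
    | one => simp
    | mul x y _ _ hx hy =>
      have : g * (x * y) * g⁻¹ = (g * x * g⁻¹) * (g * y * g⁻¹) := by group
      rw [this]
      exact Subgroup.mul_mem _ hx hy
    | inv x _ hx =>
      have : g * x⁻¹ * g⁻¹ = (g * x * g⁻¹)⁻¹ := by group
      rw [this]
      exact Subgroup.inv_mem _ hx
  exact Subgroup.is_normal_topologicalClosure _

/-- The subgroup `E N^*` viewed inside `N` (if `E ≤ N`, then `E N^* ≤ N`). -/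
def relationDenominator (p : ℕ) {F : Type*} [Group F] [TopologicalSpace F] [IsTopologicalGroup F]
    (E N : Subgroup F) : Subgroup N :=
  (E ⊔ relativeFrattini p N).subgroupOf N

instance (p : ℕ) {F : Type*} [Group F] [TopologicalSpace F] [IsTopologicalGroup F]
    (E N : Subgroup F) [E.Normal] [N.Normal] : (relationDenominator p E N).Normal :=
  inferInstanceAs ((E ⊔ relativeFrattini p N).subgroupOf N).Normal

/-- The group `N ⧸ E N^*`, written additively. -/
def RelationModule (p : ℕ) {F : Type*} [Group F] [TopologicalSpace F] [IsTopologicalGroup F]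
    (E N : Subgroup F) [E.Normal] [N.Normal] : Type _ :=
  Additive (N ⧸ relationDenominator p E N)

open scoped commutatorElement in
instance (p : ℕ) {F : Type*} [Group F] [TopologicalSpace F] [IsTopologicalGroup F]
    (E N : Subgroup F) [E.Normal] [N.Normal] : AddCommGroup (RelationModule p E N) :=
  { (inferInstance : AddGroup (Additive (N ⧸ relationDenominator p E N))) with
    add_comm := by
      intro x y
      change N ⧸ relationDenominator p E N at x y
      change x * y = y * x
      induction x using QuotientGroup.induction_on with | _ x =>
      induction y using QuotientGroup.induction_on with | _ y =>
      rw [← QuotientGroup.mk_mul, ← QuotientGroup.mk_mul, QuotientGroup.eq, relationDenominator,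
        Subgroup.mem_subgroupOf]
      refine Subgroup.mem_sup_right (Subgroup.le_topologicalClosure _ (Subgroup.mem_sup_right ?_))
      have : (((x * y)⁻¹ * (y * x) : N) : F) = ⁅(y : F)⁻¹, (x : F)⁻¹⁆ := by
        simp [commutatorElement_def, mul_assoc]
      rw [this]
      exact Subgroup.commutator_mem_commutator (Subgroup.mem_top _) (N.inv_mem x.2) }

/-- The `𝔽_p`-vector space structure on `N ⧸ E N^*`. -/
instance (p : ℕ) {F : Type*} [Group F] [TopologicalSpace F] [IsTopologicalGroup F]
    (E N : Subgroup F) [E.Normal] [N.Normal] : Module (ZMod p) (RelationModule p E N) :=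
  AddCommGroup.zmodModule (n := p) (by
    intro x
    change N ⧸ relationDenominator p E N at x
    change x ^ p = 1
    induction x using QuotientGroup.induction_on with | _ x =>
    rw [← QuotientGroup.mk_pow, QuotientGroup.eq_one_iff, relationDenominator,
      Subgroup.mem_subgroupOf]
    refine Subgroup.mem_sup_right (Subgroup.le_topologicalClosure _ (Subgroup.mem_sup_left ?_))
    exact Subgroup.subset_closure ⟨x, x.2, by simp⟩)

/-- `r_E(G) = dim (N ⧸ E N^*)` for a presentation `G ≅ F_n ⧸ N`, where `E` is a characteristic
subgroup of `F_n` and `G` satisfies `d(G) = n` and `E(G) = 1`. -/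
noncomputable def relationRank {p n : ℕ} (E : Subgroup (FreeProP p n)) [E.Normal]
    (G : Type*) [Group G] [TopologicalSpace G] [IsTopologicalGroup G] : Cardinal :=
  Module.rank (ZMod p)
    (RelationModule p E (presentation p n G : FreeProP p n →* G).ker)

/-! ### Continuous cohomology with coefficients in `𝔽_p` in degrees 1 and 2 -/

/-- `H¹(G, 𝔽_p)` for the trivial action: continuous homomorphisms from `G` to `𝔽_p`. -/
def contH1 (p : ℕ) (G : Type*) [Group G] [TopologicalSpace G] :
    Submodule (ZMod p) (G → ZMod p) where
  carrier := {f | Continuous f ∧ ∀ g h, f (g * h) = f g + f h}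
  add_mem' := by
    rintro a b ⟨ha, ha'⟩ ⟨hb, hb'⟩
    refine ⟨continuous_of_discreteTopology (f := fun z : ZMod p × ZMod p => z.1 + z.2) |>.comp
      (ha.prodMk hb), fun g h => ?_⟩
    simp only [Pi.add_apply, ha', hb']
    ring
  zero_mem' := ⟨continuous_const, fun _ _ => by simp⟩
  smul_mem' := by
    rintro c a ⟨ha, ha'⟩
    refine ⟨continuous_of_discreteTopology (f := fun z : ZMod p => c * z) |>.comp ha,
      fun g h => ?_⟩
    simp only [Pi.smul_apply, ha', smul_eq_mul]
    ring

/-- Continuous (inhomogeneous) 2-cocycles of `G` with values in the trivial module `𝔽_p`. -/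
def contCocycles2 (p : ℕ) (G : Type*) [Group G] [TopologicalSpace G] :
    Submodule (ZMod p) (G × G → ZMod p) where
  carrier := {f | Continuous f ∧
    ∀ g h k, f (h, k) - f (g * h, k) + f (g, h * k) - f (g, h) = 0}
  add_mem' := by
    rintro a b ⟨ha, ha'⟩ ⟨hb, hb'⟩
    refine ⟨continuous_of_discreteTopology (f := fun z : ZMod p × ZMod p => z.1 + z.2) |>.comp
      (ha.prodMk hb), fun g h k => ?_⟩
    simp only [Pi.add_apply]
    linear_combination ha' g h k + hb' g h k
  zero_mem' := ⟨continuous_const, fun _ _ _ => by simp⟩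
  smul_mem' := by
    rintro c a ⟨ha, ha'⟩
    refine ⟨continuous_of_discreteTopology (f := fun z : ZMod p => c * z) |>.comp ha,
      fun g h k => ?_⟩
    simp only [Pi.smul_apply, smul_eq_mul]
    linear_combination c * ha' g h k

/-- 2-coboundaries of continuous 1-cochains of `G` with values in the trivial module `𝔽_p`. -/
def contCoboundaries2 (p : ℕ) (G : Type*) [Group G] [TopologicalSpace G] :
    Submodule (ZMod p) (G × G → ZMod p) where
  carrier := {f | ∃ c : G → ZMod p, Continuous c ∧ ∀ g h, f (g, h) = c h - c (g * h) + c g}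
  add_mem' := by
    rintro a b ⟨c, hc, ha⟩ ⟨d, hd, hb⟩
    refine ⟨c + d, continuous_of_discreteTopology (f := fun z : ZMod p × ZMod p => z.1 + z.2)
      |>.comp (hc.prodMk hd), fun g h => ?_⟩
    simp only [Pi.add_apply, ha, hb]
    ring
  zero_mem' := ⟨0, continuous_const, fun _ _ => by simp⟩
  smul_mem' := by
    rintro t a ⟨c, hc, ha⟩
    refine ⟨t • c, continuous_of_discreteTopology (f := fun z : ZMod p => t * z) |>.comp hc,
      fun g h => ?_⟩
    simp only [Pi.smul_apply, ha, smul_eq_mul]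
    ring

/-- `H²(G, 𝔽_p)`, continuous 2-cocycles modulo 2-coboundaries. -/
abbrev contH2 (p : ℕ) (G : Type*) [Group G] [TopologicalSpace G] : Type _ :=
  contCocycles2 p G ⧸ (contCoboundaries2 p G).submoduleOf (contCocycles2 p G)

/-! ### Groups with an action of `{1, σ}` and weak Schur `σ`-groups -/

/-- An action of a group `{1, σ}` of order 2 on a topological group by continuous
automorphisms. -/
structure SigmaAction (G : Type*) [Group G] [TopologicalSpace G] where
  sigma : G ≃ₜ* G
  sigma_sigma : ∀ g, sigma (sigma g) = g

namespace SigmaAction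

variable {G : Type*} [Group G] [TopologicalSpace G]

/-- The odd elements of `G`. -/
def odd (s : SigmaAction G) : Set G := {a | s.sigma a = a⁻¹}

/-- The action of `σ` on 2-cocycles, `(σ f)(g, h) = f (σ g, σ h)`. -/
def cocycles2Map (p : ℕ) (s : SigmaAction G) : contCocycles2 p G →ₗ[ZMod p] contCocycles2 p G :=
  (LinearMap.funLeft (ZMod p) (ZMod p) (Prod.map s.sigma s.sigma)).restrict (by
    rintro f ⟨hf, hf'⟩
    refine ⟨hf.comp (s.sigma.continuous_toFun.prodMap s.sigma.continuous_toFun),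
      fun g h k => ?_⟩
    simpa [LinearMap.funLeft_apply] using hf' (s.sigma g) (s.sigma h) (s.sigma k))

/-- The action of `σ` on `H²(G, 𝔽_p)`. -/
def contH2Map (p : ℕ) (s : SigmaAction G) : contH2 p G →ₗ[ZMod p] contH2 p G :=
  Submodule.mapQ _ _ (s.cocycles2Map p) (by
    rintro ⟨f, hf⟩ ⟨c, hc, hfc⟩
    exact ⟨c ∘ s.sigma, hc.comp s.sigma.continuous_toFun, fun g h => by
      simpa [cocycles2Map, LinearMap.funLeft_apply] using hfc (s.sigma g) (s.sigma h)⟩)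

end SigmaAction

/-- `G` with the given action of `σ` is a weak Schur `σ`-group: a `σ`-pro-`p`-group with
`dim H²(G, 𝔽_p) ≤ dim H¹(G, 𝔽_p) < ∞`, such that `σ` acts by `-1` on both spaces. -/
structure IsWeakSchur (p : ℕ) {G : Type*} [Group G] [TopologicalSpace G] [IsTopologicalGroup G]
    (s : SigmaAction G) : Prop where
  isProP : IsProP p G
  rank_le : Module.rank (ZMod p) (contH2 p G) ≤ Module.rank (ZMod p) (contH1 p G)
  rank_lt : Module.rank (ZMod p) (contH1 p G) < Cardinal.aleph0
  odd_H1 : ∀ f ∈ contH1 p G, f ∘ s.sigma = -f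
  odd_H2 : ∀ x : contH2 p G, s.contH2Map p x = -x

/-- `H` is a Schur `E`-quotient: `H ≅ G ⧸ E(G)` for some weak Schur `σ`-group `G` with
`d(G) = n`. Being topologically finitely generated, `G` has at most the cardinality of the
continuum, so that taking `G` in the lowest universe is no restriction. -/
def IsSchurQuotient {p n : ℕ} (E : Subgroup (FreeProP p n)) [E.Normal] (H : Type*) [Group H] :
    Prop :=
  Finite H ∧ IsPGroup p H ∧
    ∃ (G : Type) (_ : Group G) (_ : TopologicalSpace G) (_ : IsTopologicalGroup G)
      (s : SigmaAction G),
      IsWeakSchur p s ∧ HasMinGenerators G n ∧ Nonempty (G ⧸ canonicalSubgroup E G ≃* H)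

open Filter Topology

/-! ### Pro-`p`-groups -/

/-! ### Characters with values in 𝔽_p. -/

section contH1

variable {p : ℕ} {G : Type*} [Group G] [TopologicalSpace G]

/-! Write F for F_n with the involution σ inverting the free generators, K = F/N and H = F/M with M
= ND. The proof compares N/EN^* and M/DM^* with each other and with H².

Suppose K = G/E(G) with G = F/R weak Schur. Choosing odd generators of G makes F → G equivariant,
and N = RE. A functional l on N/EN^* extends to a continuous cochain c on F with c(xm) = c(x) + l(m)
for m ∈ N, and the coboundary of c descends to G. If its class in H²(G) vanishes, then c differs
from an inflated cochain by a character of F. Characters kill R, which lies in the Frattini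
subgroup, so l = 0. Hence the dual of N/EN^* embeds in H²(G), compatibly with σ. This bounds the
dimension by n and gives the sign -1 (`IsWeakSchur.rank_relationModule_le`,
`IsWeakSchur.sigma_mul_mem`). The surjection N/EN^* → M/DM^* onto a space of dimension n gives the
opposite inequality.

Conversely, under (a), (b), (c) this surjection is an isomorphism, both sides having dimension n. On
M/DM^* the involution is -1 because H is a Schur D-quotient. The weak Schur group behind H may
induce a different involution, but two involutions that are -1 modulo the Frattini subgroup have a
product of p-power order on finite quotients, and as p is odd this forces the same sign
(`IsProP.involution_mul_mem`). So σ is -1 on N/EN^*, which then has a basis represented by odd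
elements r_1, ..., r_n of N. Let R be their closed normal closure and G = F/R. As H²(F) = 0, classes
in H²(G) are determined by their values at the r_i, so dim H²(G) ≤ n with sign -1 (`rank_contH2_le`,
`contH2Map_eq_neg`). A Nakayama argument in finite p-groups gives N = RE, that is G/E(G) ≅ K. -/

theorem contH1.map_one {χ : G → ZMod p} (h : χ ∈ contH1 p G) : χ 1 = 0 := by
  simpa using h.2 1 1

theorem contH1.map_inv {χ : G → ZMod p} (h : χ ∈ contH1 p G) (g : G) : χ g⁻¹ = -χ g := by
  have := h.2 g⁻¹ g
  rw [inv_mul_cancel, contH1.map_one h] at this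
  exact eq_neg_of_add_eq_zero_left this.symm

theorem contH1.comp_mem {G' : Type*} [Group G'] [TopologicalSpace G'] {χ : G → ZMod p}
    (h : χ ∈ contH1 p G) (f : G' →ₜ* G) : χ ∘ f ∈ contH1 p G' :=
  ⟨h.1.comp f.continuous_toFun, fun a b => by simp [h.2]⟩

theorem contH1.of_hom_mem (f : G →ₜ* Multiplicative (ZMod p)) :
    (fun g => Multiplicative.toAdd (f g)) ∈ contH1 p G :=
  ⟨continuous_toAdd.comp f.continuous_toFun, fun a b => by simp⟩

/-- The kernel of a continuous homomorphism to `𝔽_p`. -/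
def contH1.ker {χ : G → ZMod p} (h : χ ∈ contH1 p G) : Subgroup G where
  carrier := {g | χ g = 0}
  one_mem' := contH1.map_one h
  mul_mem' {a b} ha hb := by
    change χ (a * b) = 0
    rw [h.2, show χ a = 0 from ha, show χ b = 0 from hb, add_zero]
  inv_mem' {a} ha := by
    change χ a⁻¹ = 0
    rw [contH1.map_inv h, show χ a = 0 from ha, neg_zero]

theorem contH1.isClosed_ker {χ : G → ZMod p} (h : χ ∈ contH1 p G) :
    IsClosed (contH1.ker h : Set G) :=
  isClosed_singleton.preimage h.1

end contH1

section ProP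

variable {p : ℕ} {G : Type*} [Group G] [TopologicalSpace G] [IsTopologicalGroup G]

/-- With its converse `IsProP.of_tendsto_pow`, this describes pro-p-groups among profinite groups by
a condition on elements, which passes easily to limits, quotients and extensions. -/
theorem IsProP.tendsto_pow (h : IsProP p G) (x : G) :
    Tendsto (fun k : ℕ => x ^ p ^ k) atTop (𝓝 1) := by
  have := h.compact
  have := h.totallyDisconnected
  rw [tendsto_nhds]
  intro W hW h1
  obtain ⟨U, hU⟩ := ProfiniteGrp.exist_openNormalSubgroup_sub_open_nhds_of_one hW h1
  obtain ⟨k, hk⟩ := h.index_eq_pow U.toSubgroup inferInstance U.isOpen'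
  filter_upwards [eventually_ge_atTop k] with m hm
  apply hU
  have h2 : x ^ p ^ k ∈ U.toSubgroup := hk ▸ Subgroup.pow_index_mem U.toSubgroup x
  obtain ⟨j, rfl⟩ := Nat.exists_eq_add_of_le hm
  have h3 := U.toSubgroup.pow_mem h2 (p ^ j)
  rwa [← pow_mul, ← pow_add] at h3

theorem IsProP.of_tendsto_pow [Fact p.Prime] [CompactSpace G] [T2Space G]
    [TotallyDisconnectedSpace G]
    (h : ∀ x : G, Tendsto (fun k : ℕ => x ^ p ^ k) atTop (𝓝 1)) : IsProP p G := by
  refine ⟨inferInstance, inferInstance, inferInstance, fun U _ hU => ?_⟩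
  have : Finite (G ⧸ U) := U.quotient_finite_of_isOpen hU
  have hP : IsPGroup p (G ⧸ U) := by
    intro x
    induction x using QuotientGroup.induction_on with | _ x =>
    obtain ⟨k, hk⟩ := ((h x).eventually (hU.mem_nhds U.one_mem)).exists
    exact ⟨k, by rw [← QuotientGroup.mk_pow]; exact (QuotientGroup.eq_one_iff _).2 hk⟩
  exact IsPGroup.iff_card.1 hP

theorem IsProP.of_isPGroup [Fact p.Prime] [Finite G] [DiscreteTopology G] (h : IsPGroup p G) :
    IsProP p G := by
  refine IsProP.of_tendsto_pow fun x => ?_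
  obtain ⟨k, hk⟩ := h x
  refine tendsto_const_nhds.congr' ?_
  filter_upwards [eventually_ge_atTop k] with m hm
  obtain ⟨j, rfl⟩ := Nat.exists_eq_add_of_le hm
  rw [pow_add, pow_mul, hk, one_pow]

theorem IsProP.isPGroup_quotient [Fact p.Prime] (h : IsProP p G) (U : Subgroup G) [U.Normal]
    (hU : IsOpen (U : Set G)) : IsPGroup p (G ⧸ U) := by
  obtain ⟨k, hk⟩ := h.index_eq_pow U inferInstance hU
  exact IsPGroup.of_card hk

theorem IsProP.quotient [Fact p.Prime] (h : IsProP p G) (N : Subgroup G) [N.Normal]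
    (hN : IsClosed (N : Set G)) : IsProP p (G ⧸ N) := by
  have := h.compact
  have := h.totallyDisconnected
  have : T2Space (G ⧸ N) := by
    have := QuotientGroup.instT3Space N
    infer_instance
  -- Images of open normal subgroups form a base at 1; this makes the quotient totally disconnected.
  have : NonarchimedeanGroup (G ⧸ N) := by
    refine ⟨fun U hU => ?_⟩
    obtain ⟨W, hWU, hW, h1⟩ := mem_nhds_iff.1 hU
    obtain ⟨V, hV⟩ := ProfiniteGrp.exist_openNormalSubgroup_sub_open_nhds_of_one
      (hW.preimage (QuotientGroup.continuous_mk (N := N))) (by simpa using h1)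
    refine ⟨⟨V.toSubgroup.map (QuotientGroup.mk' N), ?_⟩, ?_⟩
    · exact QuotientGroup.isOpenMap_coe _ V.isOpen'
    · rintro _ ⟨x, hx, rfl⟩
      exact hWU (hV hx)
  refine IsProP.of_tendsto_pow fun x => ?_
  induction x using QuotientGroup.induction_on with | _ x =>
  exact ((QuotientGroup.continuous_mk (N := N)).tendsto 1).comp (h.tendsto_pow x)

/-- A proper subgroup of a finite `p`-group is killed by a nontrivial character of order `p`. -/
theorem IsPGroup.exists_hom_of_ne_top [Fact p.Prime] {Q : Type*} [Group Q] [Finite Q]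
    (hQ : IsPGroup p Q) (A : Subgroup Q) (hA : A ≠ ⊤) :
    ∃ f : Q →* Multiplicative (ZMod p), f ≠ 1 ∧ A ≤ f.ker := by
  obtain ⟨B, hB, hAB⟩ := (eq_top_or_exists_le_coatom A).resolve_left hA
  have := hQ.isNilpotent
  have : B.Normal := Subgroup.NormalizerCondition.normal_of_coatom B
    Group.normalizerCondition_of_isNilpotent hB
  obtain ⟨a, ha⟩ := IsPGroup.iff_card.1 hQ
  obtain ⟨b, hb⟩ := IsPGroup.iff_card.1 (hQ.to_subgroup B)
  have hlt : Nat.card B < Nat.card Q := by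
    have h1 := B.card_le_card_group
    refine lt_of_le_of_ne h1 fun h2 => hB.1 (Subgroup.eq_top_of_card_eq _ h2)
  have hba : b < a := by
    rw [ha, hb] at hlt
    exact (Nat.pow_lt_pow_iff_right (Fact.out : p.Prime).one_lt).1 hlt
  -- The maximal subgroup B lies with index p in some subgroup C, which by maximality is all of Q.
  obtain ⟨C, hC, hBC⟩ := Sylow.exists_subgroup_card_pow_succ (G := Q) (p := p)
    (ha ▸ pow_dvd_pow p hba) hb
  have hCtop : C = ⊤ := by
    refine hB.2 C (lt_of_le_of_ne hBC ?_)
    rintro rfl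
    rw [hb] at hC
    exact absurd (Nat.pow_right_injective (Fact.out : p.Prime).two_le hC) (by omega)
  have hcard : Nat.card (Q ⧸ B) = p := by
    have h1 := B.card_eq_card_quotient_mul_card_subgroup
    have h2 : Nat.card Q = p ^ (b + 1) := by rw [← hC, hCtop, Subgroup.card_top]
    rw [h2, hb, pow_succ', ] at h1
    exact (Nat.eq_of_mul_eq_mul_right (pow_pos (Fact.out : p.Prime).pos b) h1).symm
  let e : (Q ⧸ B) ≃* Multiplicative (ZMod p) :=
    mulEquivOfPrimeCardEq (p := p) hcard (by simp)
  refine ⟨e.toMonoidHom.comp (QuotientGroup.mk' B), fun h => ?_, fun x hx => ?_⟩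
  · refine hB.1 ((Subgroup.eq_top_iff' B).2 fun x => ?_)
    have := DFunLike.congr_fun h x
    simpa using this
  · simpa using hAB hx

/-- A closed subgroup not killed by any nontrivial continuous homomorphism to `𝔽_p` is the
whole group. -/
theorem IsProP.eq_top_of_forall_contH1 [Fact p.Prime] (h : IsProP p G) (A : Subgroup G)
    (hA : IsClosed (A : Set G))
    (H : ∀ χ ∈ contH1 p G, (∀ x ∈ A, χ x = 0) → χ = 0) : A = ⊤ := by
  have := h.compact
  have := h.totallyDisconnected
  rw [Subgroup.eq_top_iff']
  intro g
  by_contra hg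
  -- As A is closed, some coset gU misses A, so A remains a proper subgroup in the finite p-group
  -- G/U.
  obtain ⟨U, hU⟩ := ProfiniteGrp.exist_openNormalSubgroup_sub_open_nhds_of_one
    (hA.isOpen_compl.preimage (continuous_const_mul g)) (by simpa using hg)
  have hfin : Finite (G ⧸ U.toSubgroup) := U.toSubgroup.quotient_finite_of_isOpen U.isOpen'
  have hne : A.map (QuotientGroup.mk' U.toSubgroup) ≠ ⊤ := by
    intro htop
    obtain ⟨a, ha, hag⟩ := htop.symm ▸ Subgroup.mem_top (QuotientGroup.mk' U.toSubgroup g)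
    have h1 : g⁻¹ * a ∈ U.toSubgroup := (QuotientGroup.eq (s := U.toSubgroup)).1 hag.symm
    exact hU h1 (by simpa using ha)
  obtain ⟨f, hf1, hf⟩ := (h.isPGroup_quotient U.toSubgroup U.isOpen').exists_hom_of_ne_top _ hne
  have hmem : (fun g : G => Multiplicative.toAdd (f (QuotientGroup.mk' U.toSubgroup g)))
      ∈ contH1 p G := by
    refine ⟨?_, fun a b => by simp⟩
    have : DiscreteTopology (G ⧸ U.toSubgroup) := QuotientGroup.discreteTopology U.isOpen'
    exact (continuous_of_discreteTopology (f := fun y => Multiplicative.toAdd (f y))).comp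
      (QuotientGroup.continuous_mk (N := U.toSubgroup))
  refine hf1 (MonoidHom.ext fun y => ?_)
  obtain ⟨y, rfl⟩ := QuotientGroup.mk'_surjective _ y
  have := congrFun (H _ hmem fun x hx => ?_) y
  · exact Multiplicative.toAdd.injective this
  · have := hf (Subgroup.mem_map_of_mem (QuotientGroup.mk' U.toSubgroup) hx)
    rw [MonoidHom.mem_ker] at this
    change Multiplicative.toAdd _ = 0
    rw [this]; rfl

theorem TopologicallyGenerates.le_of_isClosed {S : Set G} (hS : TopologicallyGenerates S)
    {A : Subgroup G} (hA : IsClosed (A : Set G)) (h : S ⊆ A) : A = ⊤ := by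
  rw [eq_top_iff, ← hS]
  exact Subgroup.topologicalClosure_minimal _ ((Subgroup.closure_le _).2 h) hA

theorem TopologicallyGenerates.contH1_eq_zero {S : Set G} (hS : TopologicallyGenerates S)
    {χ : G → ZMod p} (h : χ ∈ contH1 p G) (h0 : ∀ x ∈ S, χ x = 0) : χ = 0 := by
  have := hS.le_of_isClosed (contH1.isClosed_ker h) h0
  ext x
  exact (this ▸ Subgroup.mem_top x : x ∈ contH1.ker h)

theorem IsProP.topologicallyGenerates_of_contH1 [Fact p.Prime] (h : IsProP p G) {S : Set G}
    (H : ∀ χ ∈ contH1 p G, (∀ x ∈ S, χ x = 0) → χ = 0) : TopologicallyGenerates S :=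
  h.eq_top_of_forall_contH1 _ (Subgroup.isClosed_topologicalClosure _) fun χ hχ hx =>
    H χ hχ fun x hxS => hx x (Subgroup.le_topologicalClosure _ (Subgroup.subset_closure hxS))

theorem TopologicallyGenerates.hom_ext {S : Set G} (hS : TopologicallyGenerates S) {G' : Type*}
    [Group G'] [TopologicalSpace G'] [T2Space G'] {f g : G →ₜ* G'} (h : ∀ x ∈ S, f x = g x) :
    f = g := by
  have := hS.le_of_isClosed (A := (f : G →* G').eqLocus (g : G →* G'))
    (isClosed_eq f.continuous_toFun g.continuous_toFun) h
  ext x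
  exact (this ▸ Subgroup.mem_top x : x ∈ (f : G →* G').eqLocus (g : G →* G'))

theorem TopologicallyGenerates.map {S : Set G} (hS : TopologicallyGenerates S) {G' : Type*}
    [Group G'] [TopologicalSpace G'] [IsTopologicalGroup G'] (f : G →ₜ* G')
    (hf : Function.Surjective f) : TopologicallyGenerates (f '' S) := by
  have := hS.le_of_isClosed
    (A := (Subgroup.closure (f '' S)).topologicalClosure.comap (f : G →* G'))
    ((Subgroup.isClosed_topologicalClosure _).preimage f.continuous_toFun)
    (fun x hx => Subgroup.le_topologicalClosure _ (Subgroup.subset_closure ⟨x, hx, rfl⟩))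
  refine (Subgroup.eq_top_iff' _).2 fun y => ?_
  obtain ⟨x, rfl⟩ := hf y
  exact (this ▸ Subgroup.mem_top x :
    x ∈ (Subgroup.closure (f '' S)).topologicalClosure.comap (f : G →* G'))

end ProP

/-! ### Pro-`p` completions and the free pro-`p`-group -/

section Completion

variable {p : ℕ} {Γ : Type*} [Group Γ]

/-- The canonical map from a group to its pro-`p` completion. -/
def toProPCompletion (p : ℕ) (Γ : Type*) [Group Γ] : Γ →* proPCompletion p Γ where
  toFun γ := ⟨fun N => (QuotientGroup.mk γ : Γ ⧸ N.toSubgroup), fun _ _ _ => rfl⟩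
  map_one' := rfl
  map_mul' _ _ := rfl

/-- The projection of the pro-`p` completion onto one of the finite quotients. -/
def proPCompletion.proj (N : PPowerIndexNormal p Γ) : proPCompletion p Γ →ₜ* N.Quot where
  toFun x := x.1 N
  map_one' := rfl
  map_mul' _ _ := rfl
  continuous_toFun := (continuous_apply N).comp continuous_subtype_val

theorem PPowerIndexNormal.finite_quot [Fact p.Prime] (N : PPowerIndexNormal p Γ) :
    Finite N.Quot := by
  obtain ⟨k, hk⟩ := N.index_eq_pow
  refine Nat.finite_of_card_ne_zero (α := Γ ⧸ N.toSubgroup) ?_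
  change N.toSubgroup.index ≠ 0
  rw [hk]
  exact pow_ne_zero _ (Fact.out : p.Prime).ne_zero

theorem PPowerIndexNormal.isPGroup_quot [Fact p.Prime] (N : PPowerIndexNormal p Γ) :
    IsPGroup p N.Quot := by
  obtain ⟨k, hk⟩ := N.index_eq_pow
  exact IsPGroup.of_card (G := Γ ⧸ N.toSubgroup) hk

theorem proPCompletion.isProP [Fact p.Prime] : IsProP p (proPCompletion p Γ) := by
  have := fun N : PPowerIndexNormal p Γ => N.finite_quot
  have hcl : IsClosed (proPCompletion p Γ : Set (∀ N : PPowerIndexNormal p Γ, N.Quot)) := by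
    have : (proPCompletion p Γ : Set (∀ N : PPowerIndexNormal p Γ, N.Quot)) =
        ⋂ (N) (M) (h : N.toSubgroup ≤ M.toSubgroup),
          {x | PPowerIndexNormal.transition h (x N) = x M} := by
      ext x
      simp [proPCompletion]
    rw [this]
    refine isClosed_iInter fun N => isClosed_iInter fun M => isClosed_iInter fun h => ?_
    exact isClosed_eq (continuous_of_discreteTopology.comp (continuous_apply N))
      (continuous_apply M)
  have : CompactSpace (proPCompletion p Γ) := isCompact_iff_compactSpace.1 hcl.isCompact
  refine IsProP.of_tendsto_pow fun x => ?_
  rw [tendsto_subtype_rng, tendsto_pi_nhds]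
  intro N
  exact (IsProP.of_isPGroup N.isPGroup_quot).tendsto_pow (x.1 N)

theorem PPowerIndexNormal.exists_le_inf [Fact p.Prime] (N M : PPowerIndexNormal p Γ) :
    ∃ L : PPowerIndexNormal p Γ, L.toSubgroup ≤ N.toSubgroup ∧ L.toSubgroup ≤ M.toSubgroup := by
  refine ⟨⟨N.toSubgroup ⊓ M.toSubgroup, inferInstance, ?_⟩, inf_le_left, inf_le_right⟩
  obtain ⟨k, hk⟩ := N.index_eq_pow
  obtain ⟨l, hl⟩ := M.index_eq_pow
  have hdvd : (N.toSubgroup ⊓ M.toSubgroup).index ∣ p ^ (k + l) := by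
    rw [← Subgroup.relIndex_mul_index (inf_le_right : N.toSubgroup ⊓ M.toSubgroup ≤ _),
      Subgroup.inf_relIndex_right, pow_add, ← hk, ← hl]
    exact mul_dvd_mul_right (Subgroup.relIndex_dvd_index_of_normal _ _) _
  obtain ⟨j, -, hj⟩ := (Nat.dvd_prime_pow Fact.out).1 hdvd
  exact ⟨j, hj⟩

theorem PPowerIndexNormal.exists_le_finset [Fact p.Prime] (I : Finset (PPowerIndexNormal p Γ)) :
    ∃ L : PPowerIndexNormal p Γ, ∀ N ∈ I, L.toSubgroup ≤ N.toSubgroup := by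
  classical
  induction I using Finset.induction_on with
  | empty => exact ⟨⟨⊤, inferInstance, 0, by simp⟩, by simp⟩
  | insert N I _ ih =>
    obtain ⟨L, hL⟩ := ih
    obtain ⟨L', h1, h2⟩ := L.exists_le_inf N
    refine ⟨L', fun M hM => ?_⟩
    rcases Finset.mem_insert.1 hM with rfl | hM
    · exact h2
    · exact h1.trans (hL M hM)

/-- A basic open set constrains finitely many coordinates, and all of these are determined by one
coordinate at a smaller subgroup L, where Γ surjects. -/
theorem topologicallyGenerates_range_toProPCompletion [Fact p.Prime] :
    TopologicallyGenerates (Set.range (toProPCompletion p Γ)) := by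
  refine (Subgroup.eq_top_iff' _).2 fun x => ?_
  change x ∈ closure (Subgroup.closure (Set.range (toProPCompletion p Γ)) : Set _)
  rw [mem_closure_iff]
  rintro W hW hx
  obtain ⟨W', hW', rfl⟩ := isOpen_induced_iff.1 hW
  obtain ⟨I, u, hu, hIu⟩ := isOpen_pi_iff.1 hW' x.1 hx
  obtain ⟨L, hL⟩ := PPowerIndexNormal.exists_le_finset I
  obtain ⟨γ, hγ⟩ := QuotientGroup.mk_surjective (s := L.toSubgroup) (x.1 L)
  refine ⟨toProPCompletion p Γ γ, hIu fun N hN => ?_, Subgroup.subset_closure ⟨γ, rfl⟩⟩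
  have h1 := x.2 L N (hL N hN)
  have h2 : (toProPCompletion p Γ γ).1 N = x.1 N := by
    rw [← h1, ← hγ]; rfl
  rw [h2]
  exact (hu N hN).2

variable {G : Type*} [Group G] [TopologicalSpace G] [IsTopologicalGroup G]

/-- The preimage of an open normal subgroup of a pro-`p`-group. -/
def IsProP.preimage [Fact p.Prime] (h : IsProP p G) (f : Γ →* G) (U : Subgroup G) [U.Normal]
    (hU : IsOpen (U : Set G)) : PPowerIndexNormal p Γ where
  toSubgroup := U.comap f
  normal := inferInstance
  index_eq_pow := by
    obtain ⟨k, hk⟩ := h.index_eq_pow U inferInstance hU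
    rw [Subgroup.index_comap]
    have := Subgroup.relIndex_dvd_index_of_normal U f.range
    rw [hk] at this
    obtain ⟨j, -, hj⟩ := (Nat.dvd_prime_pow Fact.out).1 this
    exact ⟨j, hj⟩

/-- The closure of the graph of a homomorphism, in the product with the pro-`p` completion. -/
def proPGraph (p : ℕ) (f : Γ →* G) : Subgroup (proPCompletion p Γ × G) :=
  ((toProPCompletion p Γ).prod f).range.topologicalClosure

/-- By compactness the projection of the closed graph is closed, and it contains the dense image of
Γ. The closed graph turns out to be the graph of the extension of f to the completion. -/
theorem proPGraph_fst_surjective [Fact p.Prime] (h : IsProP p G) (f : Γ →* G) :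
    Function.Surjective fun z : proPGraph p f => z.1.1 := by
  have := h.compact
  have := (proPCompletion.isProP (p := p) (Γ := Γ)).compact
  have := (proPCompletion.isProP (p := p) (Γ := Γ)).t2
  have hcl : IsClosed (proPGraph p f : Set (proPCompletion p Γ × G)) :=
    Subgroup.isClosed_topologicalClosure _
  have htop := topologicallyGenerates_range_toProPCompletion.le_of_isClosed
    (A := (proPGraph p f).map (MonoidHom.fst (proPCompletion p Γ) G))
    (hcl.isCompact.image continuous_fst).isClosed (by
      rintro _ ⟨γ, rfl⟩
      exact ⟨(toProPCompletion p Γ γ, f γ),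
        Subgroup.le_topologicalClosure _ ⟨γ, rfl⟩, rfl⟩)
  intro x
  obtain ⟨z, hz, rfl⟩ := htop.symm ▸ Subgroup.mem_top x
  exact ⟨⟨z, hz⟩, rfl⟩

/-- For U open normal in G, the map Γ → G/U factors through a finite p-quotient of Γ, hence extends
to the completion. The closed graph lies in the equalizer of this extension and the projection from
G, so g ∈ U for every U. -/
theorem proPGraph_eq_one [Fact p.Prime] (h : IsProP p G) (f : Γ →* G) {g : G}
    (hg : ((1, g) : proPCompletion p Γ × G) ∈ proPGraph p f) : g = 1 := by
  have := h.compact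
  have := h.totallyDisconnected
  have := h.t2
  by_contra hne
  obtain ⟨U, hU⟩ := ProfiniteGrp.exist_openNormalSubgroup_sub_open_nhds_of_one
    (isOpen_compl_singleton (x := g)) (Ne.symm hne)
  have hdisc : DiscreteTopology (G ⧸ U.toSubgroup) := QuotientGroup.discreteTopology U.isOpen'
  let N := h.preimage f U.toSubgroup U.isOpen'
  let q : N.Quot →* G ⧸ U.toSubgroup := QuotientGroup.map N.toSubgroup U.toSubgroup f le_rfl
  let h1 : proPCompletion p Γ × G →* G ⧸ U.toSubgroup :=
    q.comp ((proPCompletion.proj N : proPCompletion p Γ →* N.Quot).comp (MonoidHom.fst _ _))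
  let h2 : proPCompletion p Γ × G →* G ⧸ U.toSubgroup :=
    (QuotientGroup.mk' U.toSubgroup).comp (MonoidHom.snd _ _)
  have hc1 : Continuous h1 := (continuous_of_discreteTopology (f := q)).comp
    ((proPCompletion.proj N).continuous_toFun.comp continuous_fst)
  have hc2 : Continuous h2 := QuotientGroup.continuous_mk.comp continuous_snd
  have hle : proPGraph p f ≤ h1.eqLocus h2 := by
    refine Subgroup.topologicalClosure_minimal _ ?_ (isClosed_eq hc1 hc2)
    rintro _ ⟨γ, rfl⟩
    rfl
  have h3 : h1 (1, g) = h2 (1, g) := hle hg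
  have h4 : h1 (1, g) = 1 := by simp [h1]
  rw [h4] at h3
  have h5 : g ∈ U.toSubgroup := (QuotientGroup.eq_one_iff g).1 h3.symm
  exact hU h5 rfl

theorem proPGraph_fst_injective [Fact p.Prime] (h : IsProP p G) (f : Γ →* G) :
    Function.Injective fun z : proPGraph p f => z.1.1 := by
  rintro ⟨⟨x, y⟩, hz⟩ ⟨⟨x', y'⟩, hw⟩ hxy
  obtain rfl : x = x' := hxy
  have h1 := (proPGraph p f).mul_mem hz ((proPGraph p f).inv_mem hw)
  simp only [Prod.inv_mk, Prod.mk_mul_mk, mul_inv_cancel] at h1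
  have h2 := proPGraph_eq_one h f h1
  obtain rfl : y = y' := mul_inv_eq_one.1 h2
  rfl

/-- The universal property of the pro-`p` completion. -/
noncomputable def proPCompletion.lift [Fact p.Prime] (h : IsProP p G) (f : Γ →* G) :
    proPCompletion p Γ →ₜ* G :=
  let e : proPGraph p f ≃* proPCompletion p Γ :=
    MulEquiv.ofBijective ((MonoidHom.fst _ _).comp (proPGraph p f).subtype)
      ⟨proPGraph_fst_injective h f, proPGraph_fst_surjective h f⟩
  { ((MonoidHom.snd _ _).comp (proPGraph p f).subtype).comp e.symm.toMonoidHom with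
    continuous_toFun := by
      have := h.compact
      have := (proPCompletion.isProP (p := p) (Γ := Γ)).compact
      have := (proPCompletion.isProP (p := p) (Γ := Γ)).t2
      have hcl : IsClosed (proPGraph p f : Set (proPCompletion p Γ × G)) :=
        Subgroup.isClosed_topologicalClosure _
      have : CompactSpace (proPGraph p f) := isCompact_iff_compactSpace.1 hcl.isCompact
      have he : Continuous e.toEquiv := continuous_fst.comp continuous_subtype_val
      exact (continuous_snd.comp continuous_subtype_val).comp
        he.continuous_symm_of_equiv_compact_to_t2 }

theorem proPCompletion.lift_toProPCompletion [Fact p.Prime] (h : IsProP p G) (f : Γ →* G)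
    (γ : Γ) : proPCompletion.lift h f (toProPCompletion p Γ γ) = f γ := by
  let e : proPGraph p f ≃* proPCompletion p Γ :=
    MulEquiv.ofBijective ((MonoidHom.fst _ _).comp (proPGraph p f).subtype)
      ⟨proPGraph_fst_injective h f, proPGraph_fst_surjective h f⟩
  let z : proPGraph p f :=
    ⟨(toProPCompletion p Γ γ, f γ), Subgroup.le_topologicalClosure _ ⟨γ, rfl⟩⟩
  have : e.symm (toProPCompletion p Γ γ) = z := e.symm_apply_eq.2 rfl
  change (e.symm (toProPCompletion p Γ γ)).1.2 = f γ
  rw [this]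

end Completion

/-! ### The free pro-p-group: universal property and Hopfian property. -/

namespace FreeProP

variable {p n : ℕ} [Fact p.Prime]

theorem isProP (p n : ℕ) [Fact p.Prime] : IsProP p (FreeProP p n) := proPCompletion.isProP

instance : CompactSpace (FreeProP p n) := (isProP p n).compact

instance : T2Space (FreeProP p n) := (isProP p n).t2

instance : TotallyDisconnectedSpace (FreeProP p n) := (isProP p n).totallyDisconnected

/-- The free generators of `F_n`. -/
def gen (p n : ℕ) (i : Fin n) : FreeProP p n := toProPCompletion p _ (FreeGroup.of i)

theorem topologicallyGenerates_gen : TopologicallyGenerates (Set.range (gen p n)) := by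
  have h := topologicallyGenerates_range_toProPCompletion (p := p) (Γ := FreeGroup (Fin n))
  refine h.le_of_isClosed (Subgroup.isClosed_topologicalClosure _) ?_
  rintro _ ⟨γ, rfl⟩
  refine Subgroup.le_topologicalClosure _ ?_
  change γ ∈ (Subgroup.closure (Set.range (gen p n))).comap (toProPCompletion p _)
  have h1 : (⊤ : Subgroup (FreeGroup (Fin n))) ≤
      (Subgroup.closure (Set.range (gen p n))).comap (toProPCompletion p _) := by
    rw [← FreeGroup.closure_range_of, Subgroup.closure_le]
    rintro _ ⟨i, rfl⟩
    exact Subgroup.subset_closure ⟨i, rfl⟩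
  exact h1 (Subgroup.mem_top γ)

variable {G : Type*} [Group G] [TopologicalSpace G] [IsTopologicalGroup G]

/-- The universal property of `F_n`. -/
noncomputable def lift (h : IsProP p G) (x : Fin n → G) : FreeProP p n →ₜ* G :=
  proPCompletion.lift h (FreeGroup.lift x)

@[simp]
theorem lift_gen (h : IsProP p G) (x : Fin n → G) (i : Fin n) : lift h x (gen p n i) = x i := by
  rw [lift, gen, proPCompletion.lift_toProPCompletion, FreeGroup.lift_apply_of]

theorem hom_ext {G : Type*} [Group G] [TopologicalSpace G] [T2Space G]
    {f g : FreeProP p n →ₜ* G} (h : ∀ i, f (gen p n i) = g (gen p n i)) : f = g := by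
  refine topologicallyGenerates_gen.hom_ext ?_
  rintro _ ⟨i, rfl⟩
  exact h i

theorem surjective_of_generates [T2Space G] {f : FreeProP p n →ₜ* G}
    (h : TopologicallyGenerates (Set.range fun i => f (gen p n i))) : Function.Surjective f := by
  have := h.le_of_isClosed (A := (f : FreeProP p n →* G).range)
    (isCompact_range f.continuous_toFun).isClosed (by rintro _ ⟨i, rfl⟩; exact ⟨_, rfl⟩)
  intro y
  exact (this ▸ Subgroup.mem_top y : y ∈ (f : FreeProP p n →* G).range)

theorem generates_of_surjective {f : FreeProP p n →ₜ* G} (h : Function.Surjective f) :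
    TopologicallyGenerates (Set.range fun i => f (gen p n i)) := by
  have := (topologicallyGenerates_gen (p := p) (n := n)).map f h
  rwa [← Set.range_comp] at this

theorem contH1_ext {χ ψ : FreeProP p n → ZMod p} (hχ : χ ∈ contH1 p (FreeProP p n))
    (hψ : ψ ∈ contH1 p (FreeProP p n)) (h : ∀ i, χ (gen p n i) = ψ (gen p n i)) : χ = ψ := by
  refine sub_eq_zero.1 (topologicallyGenerates_gen.contH1_eq_zero (sub_mem hχ hψ) ?_)
  rintro _ ⟨i, rfl⟩
  simp [h i]

theorem exists_contH1 (v : Fin n → ZMod p) :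
    ∃ χ ∈ contH1 p (FreeProP p n), ∀ i, χ (gen p n i) = v i := by
  have h : IsPGroup p (Multiplicative (ZMod p)) := IsPGroup.of_card (n := 1) (by simp)
  refine ⟨_, contH1.of_hom_mem (lift (IsProP.of_isPGroup h) fun i => Multiplicative.ofAdd (v i)),
    fun i => by simp⟩

/-- A surjective continuous endomorphism of `F_n` is injective. -/
theorem injective_of_surjective (f : FreeProP p n →ₜ* FreeProP p n)
    (hf : Function.Surjective f) : Function.Injective f := by
  refine (injective_iff_map_eq_one (f : FreeProP p n →* FreeProP p n)).2 fun x hx => ?_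
  by_contra hne
  obtain ⟨U, hU⟩ := ProfiniteGrp.exist_openNormalSubgroup_sub_open_nhds_of_one
    (isOpen_compl_singleton (x := x)) (Ne.symm hne)
  let Q := FreeProP p n ⧸ U.toSubgroup
  have hfin : Finite Q := U.toSubgroup.quotient_finite_of_isOpen U.isOpen'
  have hdisc : DiscreteTopology Q := QuotientGroup.discreteTopology U.isOpen'
  -- There are finitely many homomorphisms F_n → Q. Precomposition with f is injective on them,
  -- hence surjective, so the projection to Q factors through f and kills x.
  have hinj : Function.Injective fun (g : FreeProP p n →ₜ* Q) i => g (gen p n i) :=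
    fun g g' h => hom_ext (congrFun h)
  have : Finite (FreeProP p n →ₜ* Q) := Finite.of_injective _ hinj
  have hinj' : Function.Injective fun g : FreeProP p n →ₜ* Q => g.comp f := by
    intro g g' h
    ext y
    obtain ⟨z, rfl⟩ := hf y
    exact DFunLike.congr_fun h z
  obtain ⟨g, hg⟩ := Finite.surjective_of_injective hinj'
    { QuotientGroup.mk' U.toSubgroup with continuous_toFun := QuotientGroup.continuous_mk }
  have h1 := DFunLike.congr_fun hg x
  have h2 : g.comp f x = 1 := by
    change g (f x) = 1
    rw [show f x = 1 from hx, map_one]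
  have h3 : (QuotientGroup.mk x : Q) = 1 := h1.symm.trans h2
  exact hU ((QuotientGroup.eq_one_iff x).1 h3) rfl

/-- A surjective continuous endomorphism of `F_n`, as an automorphism. -/
noncomputable def equivOfSurjective (f : FreeProP p n →ₜ* FreeProP p n)
    (hf : Function.Surjective f) : FreeProP p n ≃ₜ* FreeProP p n :=
  let e := MulEquiv.ofBijective (f : FreeProP p n →* FreeProP p n)
    ⟨injective_of_surjective f hf, hf⟩
  { e with
    continuous_toFun := f.continuous_toFun
    continuous_invFun :=
      (show Continuous e.toEquiv from
        f.continuous_toFun).continuous_symm_of_equiv_compact_to_t2 }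

end FreeProP

/-! ### Subgroups of the Frattini subgroup -/

/-- `N` is contained in the Frattini subgroup of the pro-`p`-group `G`, i.e. is killed by all
continuous homomorphisms to `𝔽_p`. -/
def InFrattini (p : ℕ) {G : Type*} [Group G] [TopologicalSpace G] (N : Subgroup G) : Prop :=
  ∀ χ ∈ contH1 p G, ∀ x ∈ N, χ x = 0

theorem InFrattini.mono {p : ℕ} {G : Type*} [Group G] [TopologicalSpace G] {M N : Subgroup G}
    (h : InFrattini p N) (hMN : M ≤ N) : InFrattini p M := fun χ hχ x hx => h χ hχ x (hMN hx)

theorem InFrattini.sup {p : ℕ} {G : Type*} [Group G] [TopologicalSpace G] {M N : Subgroup G}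
    (hM : InFrattini p M) (hN : InFrattini p N) : InFrattini p (M ⊔ N) := fun χ hχ _ hx =>
  (sup_le (hM χ hχ) (hN χ hχ) : M ⊔ N ≤ contH1.ker hχ) hx

theorem IsTopCharacteristic.apply_mem {G : Type*} [Group G] [TopologicalSpace G]
    (E : Subgroup G) [hE : IsTopCharacteristic E] (α : G ≃ₜ* G) {x : G} (hx : x ∈ E) :
    α x ∈ E := hE.map_eq α ▸ Subgroup.mem_map_of_mem (α : G →* G) hx

namespace FreeProP

variable {p n : ℕ} [Fact p.Prime]

/-- The automorphism `x_j ↦ x_j x_k` of `F_n` for `j ≠ k`. -/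
theorem exists_transvection {j k : Fin n} (hjk : j ≠ k) :
    ∃ α : FreeProP p n ≃ₜ* FreeProP p n, α (gen p n j) = gen p n j * gen p n k ∧
      ∀ i ≠ j, α (gen p n i) = gen p n i := by
  let f := lift (isProP p n) (Function.update (gen p n) j (gen p n j * gen p n k))
  have hfj : f (gen p n j) = gen p n j * gen p n k := by simp [f]
  have hfi : ∀ i ≠ j, f (gen p n i) = gen p n i := fun i hi => by simp [f, hi]
  have hf : Function.Surjective f := by
    have hgen : ∀ i, gen p n i ∈ (f : FreeProP p n →* FreeProP p n).range := by
      intro i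
      by_cases hi : i = j
      · subst hi
        refine ⟨gen p n i * (gen p n k)⁻¹, ?_⟩
        change f _ = _
        rw [map_mul, map_inv, hfj, hfi k hjk.symm, mul_inv_cancel_right]
      · exact ⟨_, hfi i hi⟩
    have htop := topologicallyGenerates_gen.le_of_isClosed
      (A := (f : FreeProP p n →* FreeProP p n).range)
      (isCompact_range f.continuous_toFun).isClosed (by rintro _ ⟨i, rfl⟩; exact hgen i)
    intro y
    exact (htop ▸ Subgroup.mem_top y : y ∈ (f : FreeProP p n →* FreeProP p n).range)
  exact ⟨equivOfSurjective f hf, hfj, hfi⟩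

/-- The basis of `Hom(F_n, 𝔽_p)` dual to the free generators. -/
theorem exists_dual_basis (p n : ℕ) [Fact p.Prime] :
    ∃ e : Fin n → FreeProP p n → ZMod p, (∀ i, e i ∈ contH1 p (FreeProP p n)) ∧
      (∀ i j, e i (gen p n j) = (Pi.single i 1 : Fin n → ZMod p) j) ∧
      ∀ θ ∈ contH1 p (FreeProP p n), θ = ∑ i, θ (gen p n i) • e i := by
  choose e he hei using fun i : Fin n => exists_contH1 (p := p) (Pi.single i (1 : ZMod p))
  have hexp : ∀ θ ∈ contH1 p (FreeProP p n), θ = ∑ i, θ (gen p n i) • e i := by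
    intro θ hθ
    refine contH1_ext hθ (Submodule.sum_mem _ fun i _ => Submodule.smul_mem _ _ (he i))
      fun l => ?_
    simp [Finset.sum_apply, hei, Pi.single_apply]
  exact ⟨e, he, hei, hexp⟩

/-- Proper closed characteristic subgroups of `F_n` are contained in the Frattini subgroup. -/
theorem inFrattini_of_isTopCharacteristic (E : Subgroup (FreeProP p n)) [IsTopCharacteristic E]
    (hE : IsClosed (E : Set (FreeProP p n))) (hE' : E ≠ ⊤) : InFrattini p E := by
  -- If one nonzero character χ vanishes on E, then all do: for a transvection α, χ ∘ α - χ is a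
  -- nonzero multiple of a dual basis vector e_j and vanishes on E again. So E lies in the Frattini
  -- subgroup unless no nonzero character kills it, and then E is everything.
  by_contra hnot
  refine hE' ((isProP p n).eq_top_of_forall_contH1 E hE fun χ hχ hχE => ?_)
  by_contra hχ0
  refine hnot fun ψ hψ x hx => ?_
  have hk : ∃ k, χ (gen p n k) ≠ 0 := by
    by_contra! h
    exact hχ0 (contH1_ext hχ (zero_mem _) (by simpa using h))
  obtain ⟨k, hk⟩ := hk
  obtain ⟨e, he, hei, hexp⟩ := exists_dual_basis p n
  have hej : ∀ j ≠ k, ∀ y ∈ E, e j y = 0 := by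
    intro j hj y hy
    obtain ⟨α, hα1, hα2⟩ := exists_transvection (p := p) hj
    have h1 : χ ∘ α = χ + χ (gen p n k) • e j := by
      refine contH1_ext (contH1.comp_mem hχ (α : FreeProP p n →ₜ* FreeProP p n))
        (add_mem hχ (Submodule.smul_mem _ _ (he j))) fun i => ?_
      by_cases hi : i = j
      · subst hi
        simp [hα1, hχ.2, hei]
      · simp [hα2 i hi, hei, hi]
    have h2 := congrFun h1 y
    simp only [Function.comp_apply, Pi.add_apply, Pi.smul_apply, smul_eq_mul,
      hχE _ (IsTopCharacteristic.apply_mem E α hy), hχE y hy, zero_add] at h2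
    exact (mul_eq_zero.1 h2.symm).resolve_left hk
  have hek : ∀ y ∈ E, e k y = 0 := by
    intro y hy
    have h1 := congrFun (hexp χ hχ) y
    rw [hχE y hy, Finset.sum_apply, Finset.sum_eq_single k] at h1
    · exact (mul_eq_zero.1 h1.symm).resolve_left hk
    · intro i _ hi
      simp [hej i hi y hy]
    · simp
  rw [hexp ψ hψ, Finset.sum_apply]
  refine Finset.sum_eq_zero fun i _ => ?_
  by_cases hi : i = k
  · subst hi; simp [hek x hx]
  · simp [hej i hi x hx]

variable {G : Type*} [Group G] [TopologicalSpace G] [IsTopologicalGroup G]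

/-- If `d(G) = n`, then the kernel of any surjection `F_n → G` is contained in the Frattini
subgroup. -/
theorem inFrattini_ker (hG : IsProP p G) (hd : HasMinGenerators G n) (φ : FreeProP p n →ₜ* G)
    (hφ : Function.Surjective φ) : InFrattini p (φ : FreeProP p n →* G).ker := by
  by_contra hnot
  have hnot' : ∃ χ ∈ contH1 p (FreeProP p n), ∃ m, φ m = 1 ∧ χ m ≠ 0 := by
    simpa [InFrattini, MonoidHom.mem_ker] using hnot
  obtain ⟨χ, hχ, m, hm, hχm⟩ := hnot'
  obtain ⟨e, he, hei, hexp⟩ := exists_dual_basis p n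
  obtain ⟨j, hj⟩ : ∃ j, e j m ≠ 0 := by
    by_contra! h
    rw [hexp χ hχ, Finset.sum_apply] at hχm
    exact hχm (Finset.sum_eq_zero fun i _ => by simp [h i])
  obtain ⟨r, rfl⟩ : ∃ r, n = r + 1 := ⟨n - 1, by have := j.pos; omega⟩
  -- A relation m with nonzero j-th exponent modulo the Frattini subgroup makes the j-th generator
  -- redundant, against the minimality of n.
  have hgen : TopologicallyGenerates (Set.range fun i => φ (gen p (r + 1) (j.succAbove i))) := by
    refine hG.topologicallyGenerates_of_contH1 fun ψ hψ h => ?_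
    have hψφ := contH1.comp_mem hψ φ
    have h1 : ∀ i ≠ j, (ψ ∘ φ) (gen p (r + 1) i) = 0 := by
      intro i hi
      obtain ⟨i, rfl⟩ := Fin.exists_succAbove_eq hi
      exact h _ ⟨i, rfl⟩
    have h2 := hexp _ hψφ
    rw [Finset.sum_eq_single j (fun i _ hi => by rw [h1 i hi, zero_smul]) (by simp)] at h2
    have h3 : (ψ ∘ φ) (gen p (r + 1) j) = 0 := by
      have := congrFun h2 m
      rw [Function.comp_apply, hm, contH1.map_one hψ, Pi.smul_apply, smul_eq_mul] at this
      exact (mul_eq_zero.1 this.symm).resolve_right hj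
    rw [h3, zero_smul] at h2
    ext y
    obtain ⟨y, rfl⟩ := hφ y
    exact congrFun h2 y
  have := hd.2 ⟨_, hgen⟩
  omega

/-- Two surjections from `F_n` with kernels in the Frattini subgroup differ by an automorphism. -/
theorem exists_equiv_comp {G : Type*} [Group G] [TopologicalSpace G] (hG : T2Space G) (φ ψ : FreeProP p n →ₜ* G)
    (hφ : Function.Surjective φ) (hψ : Function.Surjective ψ)
    (hker : InFrattini p (φ : FreeProP p n →* G).ker) :
    ∃ α : FreeProP p n ≃ₜ* FreeProP p n, ∀ x, φ (α x) = ψ x := by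
  obtain ⟨α, hα⟩ : ∃ α : FreeProP p n →ₜ* FreeProP p n, φ.comp α = ψ := by
    choose y hy using fun i => hφ (ψ (gen p n i))
    exact ⟨lift (isProP p n) y, hom_ext fun i => by simp [hy]⟩
  have hα' := DFunLike.congr_fun hα
  -- Since ψ is onto, F_n is the product of the image of α and ker φ; a character killing the former
  -- also kills the latter, hence is zero.
  have hs : Function.Surjective α := by
    have htop := (isProP p n).eq_top_of_forall_contH1
      (A := (α : FreeProP p n →* FreeProP p n).range)
      (isCompact_range α.continuous_toFun).isClosed (fun χ hχ h => by
        ext x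
        obtain ⟨y, hy⟩ := hψ (φ x)
        have h1 : (α y)⁻¹ * x ∈ (φ : FreeProP p n →* G).ker := by
          have h2 : φ (α y) = φ x := (hα' y).trans hy
          change φ ((α y)⁻¹ * x) = 1
          rw [map_mul, map_inv, h2, inv_mul_cancel]
        have h3 := hker χ hχ _ h1
        rw [hχ.2, contH1.map_inv hχ, h (α y) ⟨y, rfl⟩, neg_zero, zero_add] at h3
        exact h3)
    intro y
    exact (htop ▸ Subgroup.mem_top y : y ∈ (α : FreeProP p n →* FreeProP p n).range)
  exact ⟨equivOfSurjective α hs, hα'⟩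

end FreeProP

theorem presentation_surjective {p n : ℕ} {G : Type*} [Group G] [TopologicalSpace G]
    [IsTopologicalGroup G] (φ : FreeProP p n →ₜ* G) (hφ : Function.Surjective φ) :
    Function.Surjective (presentation p n G) := by
  have h : ∃ φ : FreeProP p n →ₜ* G, Function.Surjective φ := ⟨φ, hφ⟩
  rw [presentation, dif_pos h]
  exact h.choose_spec

/-- The chosen presentation and φ differ by an automorphism of F_n, which preserves E. The Frattini
condition on the kernel takes the place of d(G) = n. -/
theorem canonicalSubgroup_eq_map {p n : ℕ} [Fact p.Prime] (E : Subgroup (FreeProP p n))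
    [hE : IsTopCharacteristic E] {G : Type*} [Group G] [TopologicalSpace G]
    [IsTopologicalGroup G] [hG : T2Space G] (φ : FreeProP p n →ₜ* G)
    (hφ : Function.Surjective φ) (hker : InFrattini p (φ : FreeProP p n →* G).ker) :
    canonicalSubgroup E G = E.map (φ : FreeProP p n →* G) := by
  obtain ⟨α, hα⟩ := FreeProP.exists_equiv_comp hG φ (presentation p n G) hφ
    (presentation_surjective φ hφ) hker
  have : (presentation p n G : FreeProP p n →* G) =
      (φ : FreeProP p n →* G).comp (α : FreeProP p n →* FreeProP p n) := by
    ext x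
    exact (hα x).symm
  rw [canonicalSubgroup, this, ← Subgroup.map_map, hE.map_eq]

/-! ### The relation module -/

section relativeFrattini

variable {p : ℕ} {F F' : Type*} [Group F] [TopologicalSpace F] [IsTopologicalGroup F]
  [Group F'] [TopologicalSpace F'] [IsTopologicalGroup F'] {E N : Subgroup F}
  {E' N' : Subgroup F'}

theorem relativeFrattini_le_comap (f : F →ₜ* F') (hN : N ≤ N'.comap (f : F →* F')) :
    relativeFrattini p N ≤ (relativeFrattini p N').comap (f : F →* F') := by
  refine Subgroup.topologicalClosure_minimal _ ?_
    ((Subgroup.isClosed_topologicalClosure _).preimage f.continuous_toFun)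
  refine le_trans ?_ (Subgroup.comap_mono (Subgroup.le_topologicalClosure _))
  refine sup_le ((Subgroup.closure_le _).2 ?_) (Subgroup.commutator_le.2 ?_)
  · rintro _ ⟨a, ha, rfl⟩
    refine Subgroup.mem_sup_left (Subgroup.subset_closure ⟨f a, hN ha, map_pow f a p⟩)
  · intro x _ a ha
    refine Subgroup.mem_sup_right ?_
    rw [map_commutatorElement]
    exact Subgroup.commutator_mem_commutator (Subgroup.mem_top _) (hN ha)

theorem sup_relativeFrattini_le_comap (f : F →ₜ* F') (hE : E ≤ E'.comap (f : F →* F'))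
    (hN : N ≤ N'.comap (f : F →* F')) :
    E ⊔ relativeFrattini p N ≤ (E' ⊔ relativeFrattini p N').comap (f : F →* F') :=
  sup_le (hE.trans (Subgroup.comap_mono le_sup_left))
    ((relativeFrattini_le_comap f hN).trans (Subgroup.comap_mono le_sup_right))

end relativeFrattini

namespace RelationModule

variable {p : ℕ} {F : Type*} [Group F] [TopologicalSpace F] [IsTopologicalGroup F]
  {E N : Subgroup F} [E.Normal] [N.Normal]

/-- The class of an element of `N` in `N ⧸ E N^*`. -/
def mk (p : ℕ) (E : Subgroup F) {N : Subgroup F} [E.Normal] [N.Normal] (x : N) :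
    RelationModule p E N :=
  Additive.ofMul (QuotientGroup.mk x)

theorem mk_mul (x y : N) : mk p E (x * y) = mk p E x + mk p E y := rfl

theorem mk_inv (x : N) : mk p E x⁻¹ = -mk p E x := rfl

theorem mk_surjective : Function.Surjective (mk p E : N → _) := QuotientGroup.mk_surjective

theorem mk_eq_zero (x : N) : mk p E x = 0 ↔ (x : F) ∈ E ⊔ relativeFrattini p N :=
  QuotientGroup.eq_one_iff x

theorem mk_eq_zero_of_mem (x : N) (hx : (x : F) ∈ E) : mk p E x = 0 :=
  (mk_eq_zero x).2 (Subgroup.mem_sup_left hx)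

theorem mk_eq_mk (x y : N) :
    mk p E x = mk p E y ↔ (x : F)⁻¹ * y ∈ E ⊔ relativeFrattini p N :=
  QuotientGroup.eq

open scoped commutatorElement in
theorem mk_conj (m : N) (h : F) :
    mk p E ⟨h⁻¹ * m * h, by simpa using (‹N.Normal› : N.Normal).conj_mem m m.2 h⁻¹⟩ = mk p E m := by
  refine ((mk_eq_mk _ _).2 ?_).symm
  refine Subgroup.mem_sup_right (Subgroup.le_topologicalClosure _ (Subgroup.mem_sup_right ?_))
  rw [Subgroup.commutator_comm]
  have : (m : F)⁻¹ * (h⁻¹ * m * h) = ⁅(m : F)⁻¹, h⁻¹⁆ := by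
    simp [commutatorElement_def, mul_assoc]
  rw [this]
  exact Subgroup.commutator_mem_commutator (N.inv_mem m.2) (Subgroup.mem_top _)

variable {F' : Type*} [Group F'] [TopologicalSpace F'] [IsTopologicalGroup F']
  {E' N' : Subgroup F'} [E'.Normal] [N'.Normal]

/-- The map of relation modules induced by a homomorphism. -/
def map (f : F →ₜ* F') (hE : E ≤ E'.comap (f : F →* F')) (hN : N ≤ N'.comap (f : F →* F')) :
    RelationModule p E N →ₗ[ZMod p] RelationModule p E' N' :=
  let g : N →* N' := ((f : F →* F').comp N.subtype).codRestrict N' fun x => hN x.2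
  AddMonoidHom.toZModLinearMap p <| MonoidHom.toAdditive <|
    QuotientGroup.map (relationDenominator p E N) (relationDenominator p E' N') g
      fun _ hx => sup_relativeFrattini_le_comap f hE hN hx

theorem map_mk (f : F →ₜ* F') (hE : E ≤ E'.comap (f : F →* F'))
    (hN : N ≤ N'.comap (f : F →* F')) (x : N) :
    map (p := p) f hE hN (mk p E x) = mk p E' ⟨f x, hN x.2⟩ := rfl

theorem map_surjective (f : F →ₜ* F') (hE : E ≤ E'.comap (f : F →* F'))
    (hN : N ≤ N'.comap (f : F →* F')) (h : N' ≤ N.map (f : F →* F') ⊔ E') :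
    Function.Surjective (map (p := p) f hE hN) := by
  intro v
  obtain ⟨⟨m, hm⟩, rfl⟩ := mk_surjective v
  obtain ⟨_, ⟨x, hx, rfl⟩, y, hy, hxy⟩ := Subgroup.mem_sup_of_normal_right.1 (h hm)
  refine ⟨mk p E ⟨x, hx⟩, ?_⟩
  rw [map_mk, mk_eq_mk]
  refine Subgroup.mem_sup_left ?_
  subst hxy
  change (f x)⁻¹ * (f x * y) ∈ E'
  rwa [inv_mul_cancel_left]

end RelationModule

/-- The automorphism relating the two presentations and its inverse induce surjections of relation
modules in both directions. -/
theorem relationRank_eq {p n : ℕ} [Fact p.Prime] (E : Subgroup (FreeProP p n))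
    [hE : IsTopCharacteristic E] {G : Type*} [Group G] [TopologicalSpace G]
    [IsTopologicalGroup G] [hG : T2Space G] (φ : FreeProP p n →ₜ* G)
    (hφ : Function.Surjective φ) (hker : InFrattini p (φ : FreeProP p n →* G).ker) :
    relationRank E G =
      Module.rank (ZMod p) (RelationModule p E (φ : FreeProP p n →* G).ker) := by
  obtain ⟨α, hα⟩ := FreeProP.exists_equiv_comp hG φ (presentation p n G) hφ
    (presentation_surjective φ hφ) hker
  have hα' : ∀ x, presentation p n G (α.symm x) = φ x := fun x => by simp [← hα]
  refine le_antisymm ?_ ?_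
  · have hN : (φ : FreeProP p n →* G).ker ≤ (presentation p n G : FreeProP p n →* G).ker.comap
        ((α.symm : FreeProP p n →ₜ* FreeProP p n) : FreeProP p n →* FreeProP p n) :=
      fun x hx => (hα' x).trans hx
    refine LinearMap.rank_le_of_surjective _ (RelationModule.map_surjective
      (α.symm : FreeProP p n →ₜ* FreeProP p n)
      (fun x hx => IsTopCharacteristic.apply_mem E α.symm hx) hN fun x hx => ?_)
    exact Subgroup.mem_sup_left ⟨α x, (hα x).trans hx, α.symm_apply_apply x⟩
  · have hN : (presentation p n G : FreeProP p n →* G).ker ≤ (φ : FreeProP p n →* G).ker.comap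
        ((α : FreeProP p n →ₜ* FreeProP p n) : FreeProP p n →* FreeProP p n) :=
      fun x hx => (hα x).trans hx
    refine LinearMap.rank_le_of_surjective _ (RelationModule.map_surjective
      (α : FreeProP p n →ₜ* FreeProP p n)
      (fun x hx => IsTopCharacteristic.apply_mem E α hx) hN fun x hx => ?_)
    exact Subgroup.mem_sup_left ⟨α.symm x, (hα' x).trans hx, α.apply_symm_apply x⟩

/-! ### Groups with involution -/

namespace FreeProP

variable {p n : ℕ} [Fact p.Prime]

/-- The involution of `F_n` inverting the free generators. -/
noncomputable def sigma (p n : ℕ) [Fact p.Prime] : SigmaAction (FreeProP p n) :=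
  let f := lift (isProP p n) fun i => (gen p n i)⁻¹
  have hf : ∀ x, f (f x) = x := DFunLike.congr_fun
    (hom_ext (f := f.comp f) (g := ContinuousMonoidHom.id _) fun i => by simp [f])
  { sigma :=
      { f with
        invFun := f
        left_inv := hf
        right_inv := hf
        continuous_toFun := f.continuous_toFun
        continuous_invFun := f.continuous_toFun }
    sigma_sigma := hf }

@[simp]
theorem sigma_gen (i : Fin n) : (sigma p n).sigma (gen p n i) = (gen p n i)⁻¹ :=
  lift_gen (isProP p n) (fun i => (gen p n i)⁻¹) i

theorem contH1_sigma {χ : FreeProP p n → ZMod p} (hχ : χ ∈ contH1 p (FreeProP p n))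
    (x : FreeProP p n) : χ ((sigma p n).sigma x) = -χ x := by
  have h : χ ∘ (sigma p n).sigma = -χ :=
    contH1_ext (contH1.comp_mem hχ ((sigma p n).sigma : FreeProP p n →ₜ* FreeProP p n))
      (neg_mem hχ) fun i => by simp [contH1.map_inv hχ]
  exact congrFun h x

end FreeProP

namespace SigmaAction

variable {p n : ℕ} {G : Type*} [Group G] [TopologicalSpace G]

theorem mul_inv_sigma_mem_odd (s : SigmaAction G) (x : G) : x * (s.sigma x)⁻¹ ∈ s.odd := by
  change s.sigma (x * (s.sigma x)⁻¹) = (x * (s.sigma x)⁻¹)⁻¹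
  rw [map_mul, map_inv, s.sigma_sigma, mul_inv_rev, inv_inv]

theorem contH1_comp_sigma [IsTopologicalGroup G] (s : SigmaAction G)
    (h : TopologicallyGenerates s.odd) {χ : G → ZMod p} (hχ : χ ∈ contH1 p G) :
    χ ∘ s.sigma = -χ := by
  have hχ' := contH1.comp_mem hχ (s.sigma : G →ₜ* G)
  have h0 := h.contH1_eq_zero (add_mem hχ' hχ) fun x hx => by
    change χ (s.sigma x) + χ x = 0
    rw [show s.sigma x = x⁻¹ from hx, contH1.map_inv hχ, neg_add_cancel]
  exact eq_neg_of_add_eq_zero_left h0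

/-- A `σ`-pro-`p`-group on which `σ` acts by `-1` modulo the Frattini subgroup is an equivariant
quotient of `F_n`, if it can be generated by `n` elements. -/
theorem exists_equivariant [Fact p.Prime] [IsTopologicalGroup G] (hp : Odd p) (hG : IsProP p G)
    (s : SigmaAction G) (hs : ∀ χ ∈ contH1 p G, χ ∘ s.sigma = -χ)
    (x : Fin n → G) (hx : TopologicallyGenerates (Set.range x)) :
    ∃ π : FreeProP p n →ₜ* G, Function.Surjective π ∧
      ∀ y, π ((FreeProP.sigma p n).sigma y) = s.sigma (π y) := by
  have := hG.t2
  -- These elements are odd, and a character χ takes the value 2χ(x_i) on them. As 2 is invertible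
  -- modulo p, they generate G like the x_i.
  let π := FreeProP.lift hG fun i => x i * (s.sigma (x i))⁻¹
  refine ⟨π, FreeProP.surjective_of_generates (hG.topologicallyGenerates_of_contH1
    fun χ hχ h => hx.contH1_eq_zero hχ ?_), ?_⟩
  · rintro _ ⟨i, rfl⟩
    have h1 := h _ ⟨i, rfl⟩
    have h2 : χ (s.sigma (x i)) = -χ (x i) := congrFun (hs χ hχ) (x i)
    change χ (π (FreeProP.gen p n i)) = 0 at h1
    rw [FreeProP.lift_gen, hχ.2, contH1.map_inv hχ, h2, neg_neg, ← two_mul] at h1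
    refine (mul_eq_zero.1 h1).resolve_left fun h3 => ?_
    have h4 : (p : ℕ) ∣ 2 := (ZMod.natCast_eq_zero_iff 2 p).1 (by exact_mod_cast h3)
    rw [(Nat.prime_dvd_prime_iff_eq Fact.out Nat.prime_two).1 h4] at hp
    exact absurd hp (by decide)
  · have h : π.comp ((FreeProP.sigma p n).sigma : FreeProP p n →ₜ* FreeProP p n) =
        (s.sigma : G →ₜ* G).comp π := FreeProP.hom_ext fun i => by
      change π ((FreeProP.sigma p n).sigma (FreeProP.gen p n i)) =
        s.sigma (π (FreeProP.gen p n i))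
      rw [FreeProP.sigma_gen, map_inv, FreeProP.lift_gen]
      exact (s.mul_inv_sigma_mem_odd (x i)).symm
    exact DFunLike.congr_fun h

end SigmaAction

/-! ### Central extensions and the vanishing of `H²(F_n, 𝔽_p)` -/

section Extension

variable {p : ℕ} {G : Type*} [Group G] [TopologicalSpace G]

/-- The central extension of `G` by `𝔽_p` defined by a continuous 2-cocycle. -/
@[ext]
structure CocycleExtension (f : contCocycles2 p G) where
  fst : ZMod p
  snd : G

namespace CocycleExtension

variable {f : contCocycles2 p G}

theorem cocycle (f : contCocycles2 p G) (g h k : G) :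
    f.1 (h, k) + f.1 (g, h * k) = f.1 (g * h, k) + f.1 (g, h) := by
  linear_combination f.2.2 g h k

theorem cocycle_one_left (f : contCocycles2 p G) (g : G) : f.1 (1, g) = f.1 (1, 1) := by
  have := cocycle f 1 1 g
  simp only [one_mul] at this
  linear_combination this

theorem cocycle_one_right (f : contCocycles2 p G) (g : G) : f.1 (g, 1) = f.1 (1, 1) := by
  have := cocycle f g 1 1
  simp only [mul_one] at this
  linear_combination -this

instance : Mul (CocycleExtension f) :=
  ⟨fun x y => ⟨x.fst + y.fst + f.1 (x.snd, y.snd), x.snd * y.snd⟩⟩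

/-- Cocycles are not normalized, hence the correction by f(1, 1) here and in the inverse. -/
instance : One (CocycleExtension f) := ⟨⟨-f.1 (1, 1), 1⟩⟩

instance : Inv (CocycleExtension f) :=
  ⟨fun x => ⟨-x.fst - f.1 (x.snd⁻¹, x.snd) - f.1 (1, 1), x.snd⁻¹⟩⟩

@[simp] theorem mul_fst (x y : CocycleExtension f) :
    (x * y).fst = x.fst + y.fst + f.1 (x.snd, y.snd) := rfl

@[simp] theorem mul_snd (x y : CocycleExtension f) : (x * y).snd = x.snd * y.snd := rfl

@[simp] theorem one_fst : (1 : CocycleExtension f).fst = -f.1 (1, 1) := rfl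

@[simp] theorem one_snd : (1 : CocycleExtension f).snd = 1 := rfl

@[simp] theorem inv_fst (x : CocycleExtension f) :
    x⁻¹.fst = -x.fst - f.1 (x.snd⁻¹, x.snd) - f.1 (1, 1) := rfl

@[simp] theorem inv_snd (x : CocycleExtension f) : x⁻¹.snd = x.snd⁻¹ := rfl

instance : Group (CocycleExtension f) where
  mul_assoc x y z := by
    ext
    · simp only [mul_fst, mul_snd]
      linear_combination -cocycle f x.snd y.snd z.snd
    · simp [mul_assoc]
  one_mul x := by
    ext
    · simp [cocycle_one_left f x.snd]
    · simp
  mul_one x := by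
    ext
    · simp [cocycle_one_right f x.snd]
    · simp
  inv_mul_cancel x := by
    ext
    · simp only [mul_fst, inv_fst, inv_snd, one_fst]
      ring
    · simp

theorem pow_eq_one {x : CocycleExtension f} (hx : x.snd = 1) : x ^ p = 1 := by
  have h : ∀ k : ℕ, (x ^ k).snd = 1 ∧ (x ^ k).fst = k * (x.fst + f.1 (1, 1)) - f.1 (1, 1) := by
    intro k
    induction k with
    | zero => simp
    | succ k ih =>
      rw [pow_succ]
      simp only [mul_snd, mul_fst, ih.1, ih.2, hx, mul_one, true_and]
      push_cast
      ring
  ext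
  · simp [(h p).2]
  · simp [(h p).1]

/-- The underlying set of the extension is a product. -/
def equivProd (f : contCocycles2 p G) : CocycleExtension f ≃ ZMod p × G where
  toFun x := (x.fst, x.snd)
  invFun x := ⟨x.1, x.2⟩

instance : TopologicalSpace (CocycleExtension f) := .induced (equivProd f) inferInstance

/-- The extension is homeomorphic to a product. -/
def homeoProd (f : contCocycles2 p G) : CocycleExtension f ≃ₜ ZMod p × G :=
  (equivProd f).toHomeomorphOfIsInducing ⟨rfl⟩

theorem continuous_fst : Continuous (fst : CocycleExtension f → ZMod p) :=
  _root_.continuous_fst.comp (homeoProd f).continuous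

theorem continuous_snd : Continuous (snd : CocycleExtension f → G) :=
  _root_.continuous_snd.comp (homeoProd f).continuous

theorem continuous_mk {X : Type*} [TopologicalSpace X] {a : X → ZMod p} {b : X → G}
    (ha : Continuous a) (hb : Continuous b) :
    Continuous fun x => (⟨a x, b x⟩ : CocycleExtension f) :=
  (homeoProd f).symm.continuous.comp (ha.prodMk hb)

variable [IsTopologicalGroup G]

instance : IsTopologicalGroup (CocycleExtension f) where
  continuous_mul := by
    have h1 := continuous_fst.comp (_root_.continuous_fst (X := CocycleExtension f)
      (Y := CocycleExtension f))
    have h2 := continuous_fst.comp (_root_.continuous_snd (X := CocycleExtension f)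
      (Y := CocycleExtension f))
    have h3 := continuous_snd.comp (_root_.continuous_fst (X := CocycleExtension f)
      (Y := CocycleExtension f))
    have h4 := continuous_snd.comp (_root_.continuous_snd (X := CocycleExtension f)
      (Y := CocycleExtension f))
    exact continuous_mk ((h1.add h2).add (f.2.1.comp (h3.prodMk h4))) (h3.mul h4)
  continuous_inv := by
    have h1 := continuous_fst (f := f)
    have h2 := continuous_snd (f := f)
    exact continuous_mk ((h1.neg.sub (f.2.1.comp (h2.inv.prodMk h2))).sub continuous_const) h2.inv

/-- The projection of the extension. -/
def proj (f : contCocycles2 p G) : CocycleExtension f →ₜ* G where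
  toFun := snd
  map_one' := rfl
  map_mul' _ _ := rfl
  continuous_toFun := continuous_snd

/-- Elements over 1 have trivial p-th power, so by compactness elements over a neighbourhood of 1
have p-th power in a given W. The element x^(p^(k-1)) lies over such a neighbourhood for large k. -/
theorem isProP [Fact p.Prime] (hG : IsProP p G) (f : contCocycles2 p G) :
    IsProP p (CocycleExtension f) := by
  have := hG.compact
  have := hG.t2
  have := hG.totallyDisconnected
  have : CompactSpace (CocycleExtension f) := (homeoProd f).symm.compactSpace
  have : T2Space (CocycleExtension f) := (homeoProd f).symm.t2Space
  have : TotallyDisconnectedSpace (CocycleExtension f) :=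
    (homeoProd f).symm.totallyDisconnectedSpace
  refine IsProP.of_tendsto_pow fun x => ?_
  rw [tendsto_nhds]
  intro W hW h1
  have hO : IsOpen {y : CocycleExtension f | y ^ p ∈ W} := hW.preimage (continuous_pow p)
  have hcl : IsClosed (snd '' {y : CocycleExtension f | y ^ p ∈ W}ᶜ) :=
    (hO.isClosed_compl.isCompact.image continuous_snd).isClosed
  have hev := (hG.tendsto_pow x.snd).eventually (hcl.isOpen_compl.mem_nhds (x := 1) (by
    rintro ⟨y, hy, hy1⟩
    exact hy (by simpa [pow_eq_one hy1] using h1)))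
  filter_upwards [(tendsto_sub_atTop_nat 1).eventually hev, eventually_ge_atTop 1] with k hk hk1
  by_contra hnot
  refine hk ⟨x ^ p ^ (k - 1), fun h => hnot ?_, map_pow (proj f) x _⟩
  have h2 : (x ^ p ^ (k - 1)) ^ p ∈ W := h
  rwa [← pow_mul, ← pow_succ, Nat.sub_add_cancel hk1] at h2

end CocycleExtension

/-- `H²(F_n, 𝔽_p) = 0`. -/
theorem FreeProP.exists_eq_coboundary {p n : ℕ} [Fact p.Prime]
    (f : contCocycles2 p (FreeProP p n)) :
    ∃ c : FreeProP p n → ZMod p, Continuous c ∧ ∀ g h, f.1 (g, h) = c h - c (g * h) + c g := by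
  -- Freeness splits the extension; the 𝔽_p-coordinate of the section is, up to sign, a cochain with
  -- coboundary f.
  let φ := lift (CocycleExtension.isProP (isProP p n) f) fun i => ⟨0, gen p n i⟩
  have hφ : ∀ x, (φ x).snd = x := DFunLike.congr_fun
    (hom_ext (f := (CocycleExtension.proj f).comp φ) (g := ContinuousMonoidHom.id _) fun i => by
      change (φ (gen p n i)).snd = gen p n i
      simp [φ])
  refine ⟨fun x => -(φ x).fst,
    (CocycleExtension.continuous_fst.comp φ.continuous_toFun).neg, fun g h => ?_⟩
  have h1 : (φ (g * h)).fst = _ := congrArg CocycleExtension.fst (map_mul φ g h)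
  rw [CocycleExtension.mul_fst, hφ, hφ] at h1
  linear_combination -h1

end Extension

/-! ### The transgression -/

section Transgression

variable {p n : ℕ} [Fact p.Prime] {G : Type*} [Group G] [TopologicalSpace G]

/-- The difference c - d ∘ π is a character of F_n, hence vanishes on the kernel. This yields the
injectivity of the transgression. -/
theorem apply_eq_of_coboundary_eq_inflation (π : FreeProP p n →ₜ* G)
    (hker : InFrattini p (π : FreeProP p n →* G).ker) {c : FreeProP p n → ZMod p}
    (hc : Continuous c) {d : G → ZMod p} (hd : Continuous d)
    (h : ∀ x y, c y - c (x * y) + c x = d (π y) - d (π x * π y) + d (π x))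
    {m : FreeProP p n} (hm : π m = 1) : c m = c 1 := by
  have hmem : c - d ∘ π ∈ contH1 p (FreeProP p n) := by
    refine ⟨hc.sub (hd.comp π.continuous_toFun), fun x y => ?_⟩
    simp only [Pi.sub_apply, Function.comp_apply, map_mul]
    linear_combination -h x y
  have h1 : c m - d (π m) = 0 := hker _ hmem m hm
  have h2 : c 1 - d (π 1) = 0 := contH1.map_one hmem
  rw [hm] at h1
  rw [map_one] at h2
  linear_combination h1 - h2

theorem isQuotientMap_of_surjective [T2Space G] (π : FreeProP p n →ₜ* G)
    (hπ : Function.Surjective π) : IsQuotientMap π :=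
  π.continuous_toFun.isClosedMap.isQuotientMap π.continuous_toFun hπ

theorem isQuotientMap_prod_of_surjective [T2Space G] (π : FreeProP p n →ₜ* G)
    (hπ : Function.Surjective π) : IsQuotientMap (Prod.map π π) := by
  have hc : Continuous (Prod.map π π) := π.continuous_toFun.prodMap π.continuous_toFun
  exact hc.isClosedMap.isQuotientMap hc (hπ.prodMap hπ)

open RelationModule

variable {E M : Subgroup (FreeProP p n)} [E.Normal] [M.Normal]

/-- The cochain on `F_n` extending a functional on the relation module of `M`. -/
noncomputable def extendedCochain (E M : Subgroup (FreeProP p n)) [E.Normal] [M.Normal]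
    (l : Module.Dual (ZMod p) (RelationModule p E M)) (x : FreeProP p n) : ZMod p :=
  l (mk p E ⟨(Quotient.out (QuotientGroup.mk x : FreeProP p n ⧸ M))⁻¹ * x,
    QuotientGroup.eq.1 (Quotient.out_eq _)⟩)

theorem extendedCochain_mul (l : Module.Dual (ZMod p) (RelationModule p E M))
    (x : FreeProP p n) (m : M) :
    extendedCochain E M l (x * m) = extendedCochain E M l x + l (mk p E m) := by
  have h : (QuotientGroup.mk (x * m) : FreeProP p n ⧸ M) = QuotientGroup.mk x := by simp
  rw [extendedCochain, extendedCochain, ← map_add, ← mk_mul]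
  congr 3
  simp only [h, mul_assoc]

/-- Conjugation by F_n is trivial on M/EM^*, so m can be moved past y to the right. -/
theorem extendedCochain_mul_left (l : Module.Dual (ZMod p) (RelationModule p E M))
    (x : FreeProP p n) (m : M) (y : FreeProP p n) :
    extendedCochain E M l (x * m * y) = extendedCochain E M l (x * y) + l (mk p E m) := by
  have h : x * m * y = x * y * (y⁻¹ * m * y) := by group
  rw [h, ← mk_conj m y, ← extendedCochain_mul]

/-- Because E is killed in the relation module, the cochain is constant on the open cosets xE. -/
theorem continuous_extendedCochain (hE : IsOpen (E : Set (FreeProP p n))) (hEM : E ≤ M)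
    (l : Module.Dual (ZMod p) (RelationModule p E M)) : Continuous (extendedCochain E M l) := by
  refine continuous_iff_continuousAt.2 fun x => ?_
  refine (continuousAt_const (y := extendedCochain E M l x)).congr ?_
  have hU : IsOpen ((x⁻¹ * ·) ⁻¹' (E : Set (FreeProP p n))) :=
    hE.preimage (continuous_const_mul x⁻¹)
  filter_upwards [hU.mem_nhds (by simp)] with y hy
  have h := extendedCochain_mul l x ⟨x⁻¹ * y, hEM hy⟩
  rw [mk_eq_zero_of_mem ⟨x⁻¹ * y, hEM hy⟩ hy, map_zero, add_zero] at h
  rw [← h]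
  simp

/-- The coboundary of `extendedCochain` only depends on classes modulo `M`. -/
theorem coboundary_extendedCochain_mul (l : Module.Dual (ZMod p) (RelationModule p E M))
    (x y : FreeProP p n) (a b : M) :
    extendedCochain E M l (y * b) - extendedCochain E M l (x * a * (y * b)) +
      extendedCochain E M l (x * a) =
    extendedCochain E M l y - extendedCochain E M l (x * y) + extendedCochain E M l x := by
  rw [extendedCochain_mul_left, ← mul_assoc, extendedCochain_mul, extendedCochain_mul,
    extendedCochain_mul]
  ring

/-- The value at `(π x, π y)` of the cocycle defined by a functional on the relation module. -/
theorem coboundary_extendedCochain_eq (π : FreeProP p n →ₜ* G)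
    (l : Module.Dual (ZMod p) (RelationModule p E M))
    (hker : (π : FreeProP p n →* G).ker ≤ M) {x x' y y' : FreeProP p n}
    (hx : π x = π x') (hy : π y = π y') :
    extendedCochain E M l y - extendedCochain E M l (x * y) + extendedCochain E M l x =
    extendedCochain E M l y' - extendedCochain E M l (x' * y') + extendedCochain E M l x' := by
  have ha : x'⁻¹ * x ∈ M := hker (by
    change π _ = 1
    rw [map_mul, map_inv, hx, inv_mul_cancel])
  have hb : y'⁻¹ * y ∈ M := hker (by
    change π _ = 1
    rw [map_mul, map_inv, hy, inv_mul_cancel])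
  have := coboundary_extendedCochain_mul l x' y' ⟨_, ha⟩ ⟨_, hb⟩
  simpa using this

variable [T2Space G] (π : FreeProP p n →ₜ* G) (hπ : Function.Surjective π)
  (hE : IsOpen (E : Set (FreeProP p n))) (hEM : E ≤ M)
  (hker : (π : FreeProP p n →* G).ker ≤ M)

/-- The dual of the transgression, on cocycles. -/
noncomputable def transgression :
    Module.Dual (ZMod p) (RelationModule p E M) →ₗ[ZMod p] contCocycles2 p G where
  toFun l := ⟨fun g => extendedCochain E M l (Function.surjInv hπ g.2) -
      extendedCochain E M l (Function.surjInv hπ g.1 * Function.surjInv hπ g.2) +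
      extendedCochain E M l (Function.surjInv hπ g.1), by
    constructor
    -- The set-theoretic section need not be continuous; after pullback to F_n × F_n it disappears
    -- from the formula.
    · refine (isQuotientMap_prod_of_surjective π hπ).continuous_iff.2 ?_
      have hc := continuous_extendedCochain hE hEM l
      have : Continuous fun z : FreeProP p n × FreeProP p n => extendedCochain E M l z.2 -
          extendedCochain E M l (z.1 * z.2) + extendedCochain E M l z.1 := by
        fun_prop
      refine this.congr fun z => ?_
      exact coboundary_extendedCochain_eq π l hker (Function.surjInv_eq hπ _).symm
        (Function.surjInv_eq hπ _).symm
    · intro g h k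
      obtain ⟨x, rfl⟩ := hπ g
      obtain ⟨y, rfl⟩ := hπ h
      obtain ⟨z, rfl⟩ := hπ k
      have hs := fun x => Function.surjInv_eq hπ (π x)
      simp only [← map_mul]
      rw [coboundary_extendedCochain_eq π l hker (hs y) (hs z),
        coboundary_extendedCochain_eq π l hker (hs (x * y)) (hs z),
        coboundary_extendedCochain_eq π l hker (hs x) (hs (y * z)),
        coboundary_extendedCochain_eq π l hker (hs x) (hs y), mul_assoc]
      ring⟩
  map_add' l l' := by
    ext g
    simp only [extendedCochain, LinearMap.add_apply, Submodule.coe_add, Pi.add_apply]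
    ring
  map_smul' t l := by
    ext g
    simp only [extendedCochain, LinearMap.smul_apply, Submodule.coe_smul, Pi.smul_apply,
      smul_eq_mul, RingHom.id_apply]
    ring

theorem transgression_apply (l : Module.Dual (ZMod p) (RelationModule p E M))
    (x y : FreeProP p n) :
    (transgression π hπ hE hEM hker l).1 (π x, π y) =
      extendedCochain E M l y - extendedCochain E M l (x * y) + extendedCochain E M l x :=
  coboundary_extendedCochain_eq π l hker (Function.surjInv_eq hπ _) (Function.surjInv_eq hπ _)

end Transgression

/-! ### Weak Schur `σ`-groups and their relation modules -/

/-! ### The dimension of H¹. -/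

section H1

variable {p n : ℕ} [Fact p.Prime] {G : Type*} [Group G] [TopologicalSpace G]
  [IsTopologicalGroup G]

theorem rank_contH1_le {x : Fin n → G} (hx : TopologicallyGenerates (Set.range x)) :
    Module.rank (ZMod p) (contH1 p G) ≤ n := by
  let T : contH1 p G →ₗ[ZMod p] (Fin n → ZMod p) :=
    { toFun := fun χ i => χ.1 (x i)
      map_add' := fun _ _ => rfl
      map_smul' := fun _ _ => rfl }
  have hT : Function.Injective T := (injective_iff_map_eq_zero T).2 fun χ h =>
    Subtype.ext (hx.contH1_eq_zero χ.2 (by rintro _ ⟨i, rfl⟩; exact congrFun h i))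
  have := LinearMap.lift_rank_le_of_injective T hT
  simpa using this

/-- Every character of F_n kills the kernel and so descends to G; characters of F_n take arbitrary
values on the free generators. -/
theorem le_rank_contH1 {G : Type*} [Group G] [TopologicalSpace G] [T2Space G] (π : FreeProP p n →ₜ* G) (hπ : Function.Surjective π)
    (hker : InFrattini p (π : FreeProP p n →* G).ker) :
    (n : Cardinal) ≤ Module.rank (ZMod p) (contH1 p G) := by
  let T : contH1 p G →ₗ[ZMod p] (Fin n → ZMod p) :=
    { toFun := fun χ i => χ.1 (π (FreeProP.gen p n i))
      map_add' := fun _ _ => rfl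
      map_smul' := fun _ _ => rfl }
  have hT : Function.Surjective T := by
    intro v
    obtain ⟨χ, hχ, hv⟩ := FreeProP.exists_contH1 (p := p) v
    have hs : ∀ x, χ (Function.surjInv hπ (π x)) = χ x := by
      intro x
      have h := hker χ hχ ((Function.surjInv hπ (π x))⁻¹ * x) (by
        change π _ = 1
        rw [map_mul, map_inv, Function.surjInv_eq hπ, inv_mul_cancel])
      rw [hχ.2, contH1.map_inv hχ] at h
      linear_combination -h
    refine ⟨⟨fun g => χ (Function.surjInv hπ g), ?_, fun g h => ?_⟩, ?_⟩
    · refine (isQuotientMap_of_surjective π hπ).continuous_iff.2 ?_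
      exact hχ.1.congr fun x => (hs x).symm
    · simp only
      obtain ⟨x, rfl⟩ := hπ g
      obtain ⟨y, rfl⟩ := hπ h
      rw [← map_mul, hs, hs, hs, hχ.2]
    · ext i
      exact (hs _).trans (hv i)
  have := LinearMap.lift_rank_le_of_surjective T hT
  simpa using this

end H1

/-! ### Bound and sign on the relation module. -/

section Schur

variable {p n : ℕ} [Fact p.Prime] {E M : Subgroup (FreeProP p n)} [E.Normal] [M.Normal]

theorem RelationModule.finite (hE : IsOpen (E : Set (FreeProP p n))) (M : Subgroup (FreeProP p n))
    [M.Normal] : Finite (RelationModule p E M) := by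
  have hle : E ≤ E ⊔ relativeFrattini p M := le_sup_left
  have hfin : Finite (FreeProP p n ⧸ (E ⊔ relativeFrattini p M)) :=
    Subgroup.quotient_finite_of_isOpen _ (Subgroup.isOpen_mono hle hE)
  have := Subgroup.finiteIndex_of_finite_quotient (H := E ⊔ relativeFrattini p M)
  exact inferInstanceAs (Finite (M ⧸ (E ⊔ relativeFrattini p M).subgroupOf M))

variable {G : Type*} [Group G] [TopologicalSpace G] [IsTopologicalGroup G] {s : SigmaAction G}

/-- The relation module of a weak Schur `σ`-group has dimension at most `n`. -/
theorem IsWeakSchur.rank_relationModule_le (hG : IsWeakSchur p s) (π : FreeProP p n →ₜ* G)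
    (hπ : Function.Surjective π) (hfr : InFrattini p (π : FreeProP p n →* G).ker)
    (hE : IsOpen (E : Set (FreeProP p n))) (hEM : E ≤ M)
    (hker : (π : FreeProP p n →* G).ker ≤ M) (hM : M ≤ (π : FreeProP p n →* G).ker ⊔ E) :
    Module.rank (ZMod p) (RelationModule p E M) ≤ n := by
  have := hG.isProP.t2
  -- If the transgression of l is a coboundary, its cochain is constant on ker π, so l vanishes on
  -- the classes of ker π. It vanishes on E anyway, and M = (ker π)E.
  have hinj : Function.Injective 
      ((Submodule.mkQ ((contCoboundaries2 p G).submoduleOf (contCocycles2 p G))).comp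
        (transgression π hπ hE hEM hker)) := by
    refine (injective_iff_map_eq_zero _).2 fun l hl => ?_
    obtain ⟨d, hd, h⟩ := (Submodule.Quotient.mk_eq_zero _).1 hl
    ext v
    obtain ⟨⟨m, hm⟩, rfl⟩ := RelationModule.mk_surjective v
    obtain ⟨a, ha, b, hb, rfl⟩ := Subgroup.mem_sup_of_normal_right.1 (hM hm)
    change l (RelationModule.mk p E (⟨a, hker ha⟩ * ⟨b, hEM hb⟩)) = 0
    rw [RelationModule.mk_mul, RelationModule.mk_eq_zero_of_mem ⟨b, hEM hb⟩ hb, add_zero]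
    have h1 := apply_eq_of_coboundary_eq_inflation π hfr (continuous_extendedCochain hE hEM l) hd
      (fun x y => (transgression_apply π hπ hE hEM hker l x y).symm.trans (h (π x) (π y))) ha
    have h2 := extendedCochain_mul l 1 ⟨a, hker ha⟩
    rw [one_mul, h1] at h2
    exact left_eq_add.1 h2
  have hfin := RelationModule.finite (p := p) hE M
  have h1 := LinearMap.lift_rank_le_of_injective _ hinj
  have h2 : Module.rank (ZMod p) (contH1 p G) ≤ n :=
    rank_contH1_le (FreeProP.generates_of_surjective hπ)
  have h3 := Cardinal.lift_le.2 (hG.rank_le.trans h2)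
  have h4 := h1.trans h3
  rw [← Module.finrank_eq_rank, Subspace.dual_finrank_eq] at h4
  rw [← Module.finrank_eq_rank]
  simpa using h4

/-- The involution acts by `-1` on the relation module of a weak Schur `σ`-group. -/
theorem IsWeakSchur.sigma_mul_mem (hG : IsWeakSchur p s) (π : FreeProP p n →ₜ* G)
    (hπ : Function.Surjective π) (hfr : InFrattini p (π : FreeProP p n →* G).ker)
    (hs : ∀ y, π ((FreeProP.sigma p n).sigma y) = s.sigma (π y))
    (hE : IsOpen (E : Set (FreeProP p n))) (hσE : ∀ x ∈ E, (FreeProP.sigma p n).sigma x ∈ E)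
    (hEM : E ≤ M)
    (hker : (π : FreeProP p n →* G).ker ≤ M) (hM : M ≤ (π : FreeProP p n →* G).ker ⊔ E)
    {m : FreeProP p n} (hm : m ∈ M) :
    (FreeProP.sigma p n).sigma m * m ∈ E ⊔ relativeFrattini p M := by
  have := hG.isProP.t2
  have hσker : ∀ x ∈ (π : FreeProP p n →* G).ker,
      (FreeProP.sigma p n).sigma x ∈ (π : FreeProP p n →* G).ker := by
    intro x hx
    change π _ = 1
    rw [hs, show π x = 1 from hx, map_one]
  obtain ⟨a, ha, b, hb, rfl⟩ := Subgroup.mem_sup_of_normal_right.1 (hM hm)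
  -- With c the cochain of l, c ∘ σ + c has as coboundary the inflation of σf + f, f being the
  -- transgression of l. Oddness of H² makes σf + f a coboundary, so c ∘ σ + c is constant on ker π.
  have key : ∀ l : Module.Dual (ZMod p) (RelationModule p E M),
      l (RelationModule.mk p E ⟨_, hker (hσker a ha)⟩) +
        l (RelationModule.mk p E ⟨a, hker ha⟩) = 0 := by
    intro l
    have h0 := hG.odd_H2 (Submodule.Quotient.mk (transgression π hπ hE hEM hker l))
    rw [eq_neg_iff_add_eq_zero] at h0
    obtain ⟨d, hd, h⟩ := (Submodule.Quotient.mk_eq_zero _).1 h0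
    have hc := continuous_extendedCochain (M := M) hE hEM l
    have h1 := apply_eq_of_coboundary_eq_inflation π hfr
      (c := fun x => extendedCochain E M l ((FreeProP.sigma p n).sigma x) +
        extendedCochain E M l x)
      ((hc.comp (FreeProP.sigma p n).sigma.continuous_toFun).add hc) hd
      (fun x y => by
        have h2 := h (π x) (π y)
        have h3 := transgression_apply π hπ hE hEM hker l x y
        have h4 := transgression_apply π hπ hE hEM hker l ((FreeProP.sigma p n).sigma x)
          ((FreeProP.sigma p n).sigma y)
        rw [hs, hs] at h4
        have h5 : (transgression π hπ hE hEM hker l).1 (s.sigma (π x), s.sigma (π y)) +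
          (transgression π hπ hE hEM hker l).1 (π x, π y) =
            d (π y) - d (π x * π y) + d (π x) := h2
        rw [h3, h4] at h5
        rw [← h5, map_mul]
        ring) ha
    have h2 := extendedCochain_mul l 1 ⟨a, hker ha⟩
    have h3 := extendedCochain_mul l 1 ⟨_, hker (hσker a ha)⟩
    simp only [one_mul, map_one] at h1 h2 h3
    rw [h2, h3] at h1
    linear_combination h1
  have h1 : RelationModule.mk p E (⟨_, hker (hσker a ha)⟩ * ⟨a, hker ha⟩) = 0 := by
    refine (Module.forall_dual_apply_eq_zero_iff (ZMod p) _).1 fun l => ?_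
    rw [RelationModule.mk_mul, map_add, key l]
  have h2 := (RelationModule.mk_eq_zero _).1 h1
  -- Normality and σ-stability of E absorb the contribution of b ∈ E.
  have h3 : (FreeProP.sigma p n).sigma (a * b) * (a * b) =
      (FreeProP.sigma p n).sigma a * ((FreeProP.sigma p n).sigma b) *
        ((FreeProP.sigma p n).sigma a)⁻¹ * ((FreeProP.sigma p n).sigma a * a) * b := by
    rw [map_mul]; group
  rw [h3]
  refine mul_mem (mul_mem (Subgroup.mem_sup_left ?_) h2) (Subgroup.mem_sup_left hb)
  exact Subgroup.Normal.conj_mem inferInstance _ (hσE b hb) _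

end Schur

/-! ### Relations and `H²` -/

section Relations

variable {p n : ℕ} [Fact p.Prime] {G : Type*} [Group G] [TopologicalSpace G]

/-- The inflation of a cocycle. -/
def inflation (π : FreeProP p n →ₜ* G) (f : contCocycles2 p G) :
    contCocycles2 p (FreeProP p n) :=
  ⟨f.1 ∘ Prod.map π π, f.2.1.comp (π.continuous_toFun.prodMap π.continuous_toFun),
    fun x y z => by simpa using f.2.2 (π x) (π y) (π z)⟩

/-- A cochain on `F_n` whose coboundary is the inflation of a cocycle. -/
noncomputable def splitting (π : FreeProP p n →ₜ* G) (f : contCocycles2 p G) :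
    FreeProP p n → ZMod p :=
  (FreeProP.exists_eq_coboundary (inflation π f)).choose

/-- `c` is continuous with coboundary the inflation of `f`. -/
def IsSplitting (π : FreeProP p n →ₜ* G) (f : contCocycles2 p G)
    (c : FreeProP p n → ZMod p) : Prop :=
  Continuous c ∧ ∀ x y, f.1 (π x, π y) = c y - c (x * y) + c x

theorem isSplitting_splitting (π : FreeProP p n →ₜ* G) (f : contCocycles2 p G) :
    IsSplitting π f (splitting π f) :=
  (FreeProP.exists_eq_coboundary (inflation π f)).choose_spec

namespace IsSplitting

variable {π : FreeProP p n →ₜ* G} {f : contCocycles2 p G} {c : FreeProP p n → ZMod p}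

/-- Two splittings differ by a character, which kills the kernel. So the value c(m) - c(1) at a
relation m depends only on f, which makes `relationEval` linear. -/
theorem sub_eq_sub (hker : InFrattini p (π : FreeProP p n →* G).ker) (hc : IsSplitting π f c)
    {c' : FreeProP p n → ZMod p} (hc' : IsSplitting π f c') {m : FreeProP p n}
    (hm : π m = 1) : c m - c 1 = c' m - c' 1 := by
  have hmem : c - c' ∈ contH1 p (FreeProP p n) := by
    refine ⟨hc.1.sub hc'.1, fun x y => ?_⟩
    simp only [Pi.sub_apply]
    linear_combination hc.2 x y - hc'.2 x y
  have h1 : c m - c' m = 0 := hker _ hmem m hm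
  have h2 : c 1 - c' 1 = 0 := contH1.map_one hmem
  linear_combination h1 - h2

theorem mul_right (hc : IsSplitting π f c) {m : FreeProP p n} (hm : π m = 1)
    (x : FreeProP p n) : c (x * m) = c x + (c m - c 1) := by
  have h1 := hc.2 x m
  have h2 := hc.2 1 1
  rw [hm, CocycleExtension.cocycle_one_right] at h1
  rw [map_one, mul_one] at h2
  linear_combination h1 - h2

theorem mul_left (hc : IsSplitting π f c) {m : FreeProP p n} (hm : π m = 1)
    (x : FreeProP p n) : c (m * x) = c x + (c m - c 1) := by
  have h1 := hc.2 m x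
  have h2 := hc.2 1 1
  rw [hm, CocycleExtension.cocycle_one_left] at h1
  rw [map_one, mul_one] at h2
  linear_combination h1 - h2

theorem inv_sub (hc : IsSplitting π f c) {m : FreeProP p n} (hm : π m = 1) :
    c m⁻¹ - c 1 = -(c m - c 1) := by
  have h := hc.mul_right hm m⁻¹
  rw [inv_mul_cancel] at h
  linear_combination -h

/-- Under this condition c is constant on cosets of ker π and descends to a continuous cochain on G.
-/
theorem mem_coboundaries [T2Space G] (hπ : Function.Surjective π) (hc : IsSplitting π f c)
    (h : ∀ m, π m = 1 → c m = c 1) : f.1 ∈ contCoboundaries2 p G := by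
  have hs : ∀ x, c (Function.surjInv hπ (π x)) = c x := by
    intro x
    have hm : π (x⁻¹ * Function.surjInv hπ (π x)) = 1 := by
      rw [map_mul, map_inv, Function.surjInv_eq hπ, inv_mul_cancel]
    have h1 := hc.mul_right hm x
    rwa [h _ hm, sub_self, add_zero, mul_inv_cancel_left] at h1
  refine ⟨fun g => c (Function.surjInv hπ g), ?_, fun g h => ?_⟩
  · refine (isQuotientMap_of_surjective π hπ).continuous_iff.2 ?_
    exact hc.1.congr fun x => (hs x).symm
  · simp only
    obtain ⟨x, rfl⟩ := hπ g
    obtain ⟨y, rfl⟩ := hπ h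
    rw [← map_mul, hs, hs, hs]
    exact hc.2 x y

/-- The elements of the kernel on which a splitting is trivial. -/
def trivialSubgroup [T2Space G] (hc : IsSplitting π f c) : Subgroup (FreeProP p n) where
  carrier := {m | π m = 1 ∧ c m = c 1}
  one_mem' := ⟨map_one π, rfl⟩
  mul_mem' {a b} ha hb := ⟨by rw [map_mul, ha.1, hb.1, mul_one], by
    rw [hc.mul_right hb.1, ha.2, hb.2, sub_self, add_zero]⟩
  inv_mem' {a} ha := ⟨by rw [map_inv, ha.1, inv_one], by
    have := hc.inv_sub ha.1
    rw [ha.2, sub_self, neg_zero] at this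
    exact sub_eq_zero.1 this⟩

/-- Evaluate c at xm = (xmx⁻¹)x by both translation rules. -/
theorem normal_trivialSubgroup [T2Space G] (hc : IsSplitting π f c) :
    hc.trivialSubgroup.Normal := by
  refine ⟨fun m hm x => ?_⟩
  have h0 : π (x * m * x⁻¹) = 1 := by rw [map_mul, map_mul, hm.1, mul_one, map_inv, mul_inv_cancel]
  refine ⟨h0, ?_⟩
  have h1 := hc.mul_left h0 x
  rw [inv_mul_cancel_right, hc.mul_right hm.1, hm.2, sub_self, add_zero] at h1
  linear_combination -h1

theorem isClosed_trivialSubgroup [T2Space G] (hc : IsSplitting π f c) :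
    IsClosed (hc.trivialSubgroup : Set (FreeProP p n)) :=
  (isClosed_eq π.continuous_toFun continuous_const).inter (isClosed_eq hc.1 continuous_const)

end IsSplitting

variable {m : ℕ} (π : FreeProP p n →ₜ* G)
  (hker : InFrattini p (π : FreeProP p n →* G).ker) (r : Fin m → FreeProP p n)
  (hr : ∀ i, π (r i) = 1)

/-- Evaluation of a cocycle at relations. -/
noncomputable def relationEval : contCocycles2 p G →ₗ[ZMod p] (Fin m → ZMod p) where
  toFun f i := splitting π f (r i) - splitting π f 1
  map_add' f g := by
    ext i
    have h : IsSplitting π (f + g) (splitting π f + splitting π g) := by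
      refine ⟨(isSplitting_splitting π f).1.add (isSplitting_splitting π g).1, fun x y => ?_⟩
      have h1 := (isSplitting_splitting π f).2 x y
      have h2 := (isSplitting_splitting π g).2 x y
      simp only [Submodule.coe_add, Pi.add_apply]
      linear_combination h1 + h2
    have := (isSplitting_splitting π (f + g)).sub_eq_sub hker h (hr i)
    simp only [Pi.add_apply] at this ⊢
    linear_combination this
  map_smul' t f := by
    ext i
    have h : IsSplitting π (t • f) (t • splitting π f) := by
      refine ⟨(isSplitting_splitting π f).1.const_smul t, fun x y => ?_⟩
      have h1 := (isSplitting_splitting π f).2 x y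
      simp only [Submodule.coe_smul, Pi.smul_apply, smul_eq_mul]
      linear_combination t * h1
    have := (isSplitting_splitting π (t • f)).sub_eq_sub hker h (hr i)
    simp only [Pi.smul_apply, smul_eq_mul, RingHom.id_apply] at this ⊢
    linear_combination this

theorem relationEval_apply {f : contCocycles2 p G} {c : FreeProP p n → ZMod p}
    (hc : IsSplitting π f c) (i : Fin m) :
    relationEval π hker r hr f i = c (r i) - c 1 :=
  (isSplitting_splitting π f).sub_eq_sub hker hc (hr i)

variable [T2Space G]

/-- The kernel elements on which the splitting is trivial form a closed normal subgroup containing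
the r_i, hence the whole kernel. -/
theorem relationEval_eq_zero
    (hπ : Function.Surjective π)
    (hgen : ∀ A : Subgroup (FreeProP p n), A.Normal → IsClosed (A : Set (FreeProP p n)) →
      (∀ i, r i ∈ A) → (π : FreeProP p n →* G).ker ≤ A)
    {f : contCocycles2 p G} (hf : relationEval π hker r hr f = 0) :
    f.1 ∈ contCoboundaries2 p G := by
  have hc := isSplitting_splitting π f
  refine hc.mem_coboundaries hπ fun m hm => ?_
  have hle := hgen hc.trivialSubgroup hc.normal_trivialSubgroup hc.isClosed_trivialSubgroup
    fun i => ⟨hr i, sub_eq_zero.1 ((relationEval_apply π hker r hr hc i).symm.trans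
      (congrFun hf i))⟩
  exact (hle hm).2

/-- Evaluation at the relations has only coboundaries in its kernel, so H² is a quotient of its
range in 𝔽_p^m. -/
theorem rank_contH2_le (π : FreeProP p n →ₜ* G)
    (hker : InFrattini p (π : FreeProP p n →* G).ker) (r : Fin m → FreeProP p n)
    (hr : ∀ i, π (r i) = 1)
    (hπ : Function.Surjective π)
    (hgen : ∀ A : Subgroup (FreeProP p n), A.Normal → IsClosed (A : Set (FreeProP p n)) →
      (∀ i, r i ∈ A) → (π : FreeProP p n →* G).ker ≤ A) :
    Module.rank (ZMod p) (contH2 p G) ≤ m := by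
  have hle : LinearMap.ker (relationEval π hker r hr) ≤
      (contCoboundaries2 p G).submoduleOf (contCocycles2 p G) := fun f hf =>
    relationEval_eq_zero π hker r hr hπ hgen hf
  have h1 := LinearMap.rank_le_of_surjective (Submodule.factor hle)
    (Submodule.factor_surjective hle)
  refine h1.trans ?_
  have h2 := (relationEval π hker r hr).quotKerEquivRange.lift_rank_eq
  have h3 := Submodule.rank_le (LinearMap.range (relationEval π hker r hr))
  rw [rank_fin_fun] at h3
  have h4 := h2.le.trans (Cardinal.lift_le.2 h3)
  simpa using h4

/-- If c splits f, then c ∘ σ + c splits σf + f. Its value at an odd relation r is c(r⁻¹) + c(r) -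
2c(1) = 0. -/
theorem contH2Map_eq_neg (π : FreeProP p n →ₜ* G)
    (hker : InFrattini p (π : FreeProP p n →* G).ker) (r : Fin m → FreeProP p n)
    (hr : ∀ i, π (r i) = 1)
    (hπ : Function.Surjective π)
    (hgen : ∀ A : Subgroup (FreeProP p n), A.Normal → IsClosed (A : Set (FreeProP p n)) →
      (∀ i, r i ∈ A) → (π : FreeProP p n →* G).ker ≤ A)
    (s : SigmaAction G)
    (hs : ∀ y, π ((FreeProP.sigma p n).sigma y) = s.sigma (π y))
    (hodd : ∀ i, (FreeProP.sigma p n).sigma (r i) = (r i)⁻¹) (x : contH2 p G) :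
    s.contH2Map p x = -x := by
  obtain ⟨f, rfl⟩ := Submodule.Quotient.mk_surjective _ x
  rw [eq_neg_iff_add_eq_zero]
  refine (Submodule.Quotient.mk_eq_zero _).2 ?_
  have hc := isSplitting_splitting π f
  refine relationEval_eq_zero π hker r hr hπ hgen (f := s.cocycles2Map p f + f) ?_
  have hc' : IsSplitting π (s.cocycles2Map p f + f)
      fun x => splitting π f ((FreeProP.sigma p n).sigma x) + splitting π f x := by
    refine ⟨(hc.1.comp (FreeProP.sigma p n).sigma.continuous_toFun).add hc.1, fun x y => ?_⟩
    change f.1 (s.sigma (π x), s.sigma (π y)) + f.1 (π x, π y) = _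
    have h1 := hc.2 x y
    have h2 := hc.2 ((FreeProP.sigma p n).sigma x) ((FreeProP.sigma p n).sigma y)
    rw [hs, hs] at h2
    simp only [h1, h2, map_mul]
    ring
  ext i
  rw [relationEval_apply π hker r hr hc' i, hodd, map_one]
  have := hc.inv_sub (hr i)
  simp only [Pi.zero_apply]
  linear_combination this

end Relations

/-! ### Finite `p`-groups -/

/-- The subgroup `N^p [P, N]` of an abstract group. -/
def algFrattini (p : ℕ) {P : Type*} [Group P] (N : Subgroup P) : Subgroup P :=
  Subgroup.closure {x | ∃ a ∈ N, x = a ^ p} ⊔ ⁅(⊤ : Subgroup P), N⁆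

theorem map_algFrattini_le {p : ℕ} {P Q : Type*} [Group P] [Group Q] (f : P →* Q) (N : Subgroup P) :
    (algFrattini p N).map f ≤ algFrattini p (N.map f) := by
  rw [algFrattini, Subgroup.map_sup, MonoidHom.map_closure, Subgroup.map_commutator]
  refine sup_le_sup ((Subgroup.closure_le _).2 ?_) (Subgroup.commutator_mono le_top le_rfl)
  rintro _ ⟨_, ⟨a, ha, rfl⟩, rfl⟩
  exact Subgroup.subset_closure ⟨f a, ⟨a, ha, rfl⟩, map_pow f a p⟩

section FinitePGroup

variable {p : ℕ} [Fact p.Prime]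

/-- The coset of x modulo the Frattini subgroup is w-stable of p-power size. The number of fixed
points of w on it is congruent to that size modulo q ≠ p, hence not zero. -/
theorem IsPGroup.exists_fixedPoint_of_hom_eq {Q : Type*} [Group Q] [Finite Q] (hQ : IsPGroup p Q)
    {w : MulAut Q} (hw : ∀ f : Q →* Multiplicative (ZMod p), ∀ x, f (w x) = f x) {q : ℕ}
    (hq : q.Prime) (hqp : q ≠ p) (hwq : w ^ q = 1) (x : Q) :
    ∃ y, w y = y ∧ ∀ f : Q →* Multiplicative (ZMod p), f y = f x := by
  classical
  have := Fact.mk hq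
  let X := {y : Q // ∀ f : Q →* Multiplicative (ZMod p), f y = f x}
  let Φ : Subgroup Q := ⨅ f : Q →* Multiplicative (ZMod p), f.ker
  let e : Φ ≃ X :=
    { toFun := fun z => ⟨x * z, fun f => by
        have h := (Subgroup.mem_iInf.1 z.2) f
        rw [MonoidHom.mem_ker] at h
        rw [map_mul, h, mul_one]⟩
      invFun := fun y => ⟨x⁻¹ * y, Subgroup.mem_iInf.2 fun f => by
        rw [MonoidHom.mem_ker, map_mul, y.2 f, map_inv, inv_mul_cancel]⟩
      left_inv := fun z => by simp
      right_inv := fun y => by simp }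
  have := Fintype.ofFinite X
  let g : Function.End X := fun y => ⟨w y, fun f => (hw f y).trans (y.2 f)⟩
  have hg : ∀ (k : ℕ) (y : X), ((g ^ k) y : X).1 = (w ^ k) y.1 := by
    intro k
    induction k with
    | zero => intro y; rfl
    | succ k ih =>
      intro y
      rw [pow_succ, pow_succ]
      exact ih (g y)
  have hgq : g ^ q ^ 1 = 1 := by
    rw [pow_one]
    funext y
    refine Subtype.ext ?_
    rw [hg, hwq]
    rfl
  have hmod := Equiv.Perm.card_fixedPoints_modEq hgq
  obtain ⟨j, hj⟩ := IsPGroup.iff_card.1 (hQ.to_subgroup Φ)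
  have hX : Fintype.card X = p ^ j := by
    rw [← Nat.card_eq_fintype_card, ← hj]
    exact (Nat.card_congr e).symm
  have hne : Nonempty (Function.fixedPoints g) := by
    by_contra hemp
    rw [not_nonempty_iff] at hemp
    rw [Fintype.card_eq_zero (α := Function.fixedPoints g), hX] at hmod
    have h1 := hq.dvd_of_dvd_pow ((Nat.modEq_zero_iff_dvd).1 hmod)
    exact hqp ((Nat.prime_dvd_prime_iff_eq hq Fact.out).1 h1)
  obtain ⟨⟨y, hy⟩⟩ := hne
  exact ⟨y.1, congrArg Subtype.val hy, y.2⟩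

/-- An automorphism of a finite `p`-group that is trivial modulo the Frattini subgroup has
`p`-power order. -/
theorem IsPGroup.exists_pow_eq_one_of_hom_eq {Q : Type*} [Group Q] [Finite Q]
    (hQ : IsPGroup p Q) {u : MulAut Q}
    (hu : ∀ f : Q →* Multiplicative (ZMod p), ∀ x, f (u x) = f x) : ∃ k : ℕ, u ^ p ^ k = 1 := by
  have hfin : Finite (MulAut Q) := Finite.of_injective _ (DFunLike.coe_injective (F := MulAut Q))
  have hord : orderOf u ≠ 0 := (orderOf_pos u).ne'
  refine ⟨_, (Nat.eq_prime_pow_of_unique_prime_dvd hord fun {q} hq hdvd => ?_) ▸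
    pow_orderOf_eq_one u⟩
  by_contra hqp
  -- This power of order q fixes a point in each coset of the Frattini subgroup; such points
  -- generate Q, so w = 1.
  set w := u ^ (orderOf u / q) with hwdef
  have hwo : orderOf w = q := orderOf_pow_orderOf_div hord hdvd
  have hwf : ∀ k : ℕ, ∀ f : Q →* Multiplicative (ZMod p), ∀ x, f ((u ^ k) x) = f x := by
    intro k
    induction k with
    | zero => intro f x; rfl
    | succ k ih =>
      intro f x
      rw [pow_succ, MulAut.mul_apply, ih, hu]
  have hw : w ≠ 1 := by
    intro h
    rw [h, orderOf_one] at hwo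
    exact hq.one_lt.ne hwo
  have htop : (w.toMonoidHom).eqLocus (MonoidHom.id Q) = ⊤ := by
    by_contra hne
    obtain ⟨f, hf1, hf⟩ := hQ.exists_hom_of_ne_top _ hne
    refine hf1 (MonoidHom.ext fun x => ?_)
    obtain ⟨y, hy, hyx⟩ := hQ.exists_fixedPoint_of_hom_eq (hwf (orderOf u / q)) hq hqp
      (orderOf_dvd_iff_pow_eq_one.1 hwo.dvd) x
    rw [← hyx f]
    exact hf hy
  refine hw (MulEquiv.ext fun x => ?_)
  exact (htop ▸ Subgroup.mem_top x : x ∈ (w.toMonoidHom).eqLocus (MonoidHom.id Q))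

/-- For central N the commutator term vanishes, so every element of N is a p-th power in N.
Iterating, it is a |P|-th power, hence trivial. -/
theorem IsPGroup.eq_bot_of_le_center {P : Type*} [Group P] [Finite P] (hP : IsPGroup p P)
    {N : Subgroup P} (hN : N ≤ Subgroup.center P) (h : N ≤ algFrattini p N) : N = ⊥ := by
  have hc : ⁅(⊤ : Subgroup P), N⁆ = ⊥ := by
    rw [Subgroup.commutator_comm, Subgroup.commutator_eq_bot_iff_le_centralizer]
    simpa [Subgroup.centralizer_univ] using hN
  have hpow : ∀ x ∈ N, ∃ y ∈ N, x = y ^ p := by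
    intro x hx
    have hx' := h hx
    rw [algFrattini, hc, sup_bot_eq] at hx'
    clear hx
    induction hx' using Subgroup.closure_induction with
    | mem x hx => exact hx
    | one => exact ⟨1, N.one_mem, (one_pow p).symm⟩
    | mul x y hx0 hy0 hx1 hy1 =>
      obtain ⟨a, ha, rfl⟩ := hx1
      obtain ⟨b, hb, rfl⟩ := hy1
      exact ⟨a * b, N.mul_mem ha hb,
        (Commute.mul_pow (Subgroup.mem_center_iff.1 (hN hb) a) p).symm⟩
    | inv x hx0 hx1 =>
      obtain ⟨a, ha, rfl⟩ := hx1
      exact ⟨a⁻¹, N.inv_mem ha, (inv_pow a p).symm⟩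
  have hpow' : ∀ k : ℕ, ∀ x ∈ N, ∃ y ∈ N, x = y ^ p ^ k := by
    intro k
    induction k with
    | zero => exact fun x hx => ⟨x, hx, by simp⟩
    | succ k ih =>
      intro x hx
      obtain ⟨y, hy, rfl⟩ := ih x hx
      obtain ⟨z, hz, rfl⟩ := hpow y hy
      exact ⟨z, hz, by rw [← pow_mul, pow_succ']⟩
  obtain ⟨k, hk⟩ := IsPGroup.iff_card.1 hP
  refine (Subgroup.eq_bot_iff_forall _).2 fun x hx => ?_
  obtain ⟨y, -, rfl⟩ := hpow' k x hx
  rw [← hk, pow_card_eq_one']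

/-- A normal subgroup `N` of a finite `p`-group `P` with `N ≤ N^p [P, N]` is trivial. -/
theorem IsPGroup.eq_bot_of_le_algFrattini {P : Type*} [Group P] [hnil : Group.IsNilpotent P] :
    Finite P → IsPGroup p P → ∀ N : Subgroup P, N ≤ algFrattini p N → N = ⊥ := by
  refine Group.nilpotent_center_quotient_ind (P := fun P _ _ => Finite P → IsPGroup p P →
    ∀ N : Subgroup P, N ≤ algFrattini p N → N = ⊥) P ?_ ?_
  · exact fun P _ _ _ _ N _ => Subsingleton.elim _ _
  · intro P _ _ ih _ hP N hN
    -- By induction N has trivial image in P/Z(P), so N is central.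
    refine hP.eq_bot_of_le_center ?_ hN
    have h := ih inferInstance (hP.to_quotient _) (N.map (QuotientGroup.mk' (Subgroup.center P)))
      ((Subgroup.map_mono hN).trans (map_algFrattini_le _ N))
    rw [Subgroup.map_eq_bot_iff, QuotientGroup.ker_mk'] at h
    exact h

end FinitePGroup

/-! ### Applications to pro-`p`-groups -/

/-- A subgroup containing the open M is closed. So modulo M the closure in N^* has no effect, and
questions reduce to the finite group F/M. -/
theorem sup_relativeFrattini_eq {p : ℕ} {F : Type*} [Group F] [TopologicalSpace F]
    [IsTopologicalGroup F] {M : Subgroup F} (hM : IsOpen (M : Set F)) (N : Subgroup F) :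
    M ⊔ relativeFrattini p N = M ⊔ algFrattini p N := by
  refine le_antisymm (sup_le le_sup_left ?_)
    (sup_le_sup_left (Subgroup.le_topologicalClosure _) _)
  refine Subgroup.topologicalClosure_minimal _ le_sup_right ?_
  exact Subgroup.isClosed_of_isOpen _ (Subgroup.isOpen_mono le_sup_left hM)

section ProP

variable {p : ℕ} [Fact p.Prime] {F : Type*} [Group F] [TopologicalSpace F] [IsTopologicalGroup F]

/-- A form of Nakayama's lemma for normal subgroups of pro-`p`-groups. -/
theorem IsProP.le_of_le_sup_relativeFrattini (hF : IsProP p F) {M N : Subgroup F} [M.Normal]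
    (hM : IsOpen (M : Set F)) (h : N ≤ M ⊔ relativeFrattini p N) : N ≤ M := by
  have := hF.compact
  have hfin : Finite (F ⧸ M) := M.quotient_finite_of_isOpen hM
  have hP := hF.isPGroup_quotient M hM
  have hnil := hP.isNilpotent
  rw [sup_relativeFrattini_eq hM] at h
  have h1 := Subgroup.map_mono (f := QuotientGroup.mk' M) h
  have h2 : M.map (QuotientGroup.mk' M) = ⊥ := by
    rw [Subgroup.map_eq_bot_iff, QuotientGroup.ker_mk']
  rw [Subgroup.map_sup, h2, bot_sup_eq] at h1
  have h3 := hP.eq_bot_of_le_algFrattini hfin _ (h1.trans (map_algFrattini_le _ N))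
  rwa [Subgroup.map_eq_bot_iff, QuotientGroup.ker_mk'] at h3

/-- If one involution acting by `-1` modulo the Frattini subgroup acts by inversion on `M ⧸ L`,
then so does any other. -/
theorem IsProP.involution_mul_mem (hF : IsProP p F) (hp : Odd p) {L M : Subgroup F} [L.Normal]
    (hL : IsOpen (L : Set F)) (s t : SigmaAction F)
    (hs : ∀ χ ∈ contH1 p F, ∀ x, χ (s.sigma x) = -χ x)
    (ht : ∀ χ ∈ contH1 p F, ∀ x, χ (t.sigma x) = -χ x)
    (hsL : ∀ x ∈ L, s.sigma x ∈ L) (htL : ∀ x ∈ L, t.sigma x ∈ L)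
    (hsM : ∀ x ∈ M, s.sigma x ∈ M) (htM : ∀ x ∈ M, t.sigma x * x ∈ L) :
    ∀ x ∈ M, s.sigma x * x ∈ L := by
  have := hF.compact
  have hfin : Finite (F ⧸ L) := L.quotient_finite_of_isOpen hL
  have hdisc : DiscreteTopology (F ⧸ L) := QuotientGroup.discreteTopology hL
  have hP := hF.isPGroup_quotient L hL
  have hmap : ∀ r : SigmaAction F, (∀ x ∈ L, r.sigma x ∈ L) →
      L.map (r.sigma.toMulEquiv : F →* F) = L := by
    intro r hr
    refine le_antisymm (Subgroup.map_le_iff_le_comap.2 hr) fun x hx => ?_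
    exact ⟨r.sigma x, hr x hx, r.sigma_sigma x⟩
  let S : MulAut (F ⧸ L) := QuotientGroup.congr L L s.sigma.toMulEquiv (hmap s hsL)
  let T : MulAut (F ⧸ L) := QuotientGroup.congr L L t.sigma.toMulEquiv (hmap t htL)
  have hS : ∀ x : F, S (QuotientGroup.mk x) = QuotientGroup.mk (s.sigma x) := fun _ => rfl
  have hT : ∀ x : F, T (QuotientGroup.mk x) = QuotientGroup.mk (t.sigma x) := fun _ => rfl
  have hTM : ∀ x ∈ M, T (QuotientGroup.mk x) = (QuotientGroup.mk x)⁻¹ := by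
    intro x hx
    refine eq_inv_of_mul_eq_one_left ?_
    exact (QuotientGroup.eq_one_iff _).2 (htM x hx)
  have hu : ∀ f : F ⧸ L →* Multiplicative (ZMod p), ∀ x, f ((S * T) x) = f x := by
    intro f x
    obtain ⟨x, rfl⟩ := QuotientGroup.mk_surjective x
    let g : F →ₜ* Multiplicative (ZMod p) :=
      { f.comp (QuotientGroup.mk' L) with
        continuous_toFun :=
          (continuous_of_discreteTopology (f := f)).comp QuotientGroup.continuous_mk }
    have h1 := hs _ (contH1.of_hom_mem g) (t.sigma x)
    rw [ht _ (contH1.of_hom_mem g) x, neg_neg] at h1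
    exact Multiplicative.toAdd.injective h1
  -- On the image of M, ST is x ↦ S(x)⁻¹, whose square is trivial. Its order also divides the odd
  -- number p^k, so it is trivial there, that is S(x) = x⁻¹.
  obtain ⟨k, hk⟩ := hP.exists_pow_eq_one_of_hom_eq hu
  have hu1 : ∀ x ∈ M, (S * T) (QuotientGroup.mk x) = (QuotientGroup.mk (s.sigma x))⁻¹ := by
    intro x hx
    rw [MulAut.mul_apply, hTM x hx, map_inv, hS]
  have hu2 : ∀ x ∈ M, ((S * T) ^ 2) (QuotientGroup.mk x) = QuotientGroup.mk x := by
    intro x hx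
    rw [pow_two, MulAut.mul_apply, hu1 x hx, map_inv, hu1 _ (hsM x hx), s.sigma_sigma, inv_inv]
  obtain ⟨j, hj⟩ := hp.pow (n := k)
  intro x hx
  have hu3 : ∀ i : ℕ, (((S * T) ^ 2) ^ i) (QuotientGroup.mk x) = QuotientGroup.mk x := by
    intro i
    induction i with
    | zero => rfl
    | succ i ih => rw [pow_succ, MulAut.mul_apply, hu2 x hx, ih]
  have h1 := DFunLike.congr_fun hk (QuotientGroup.mk x)
  rw [hj, pow_succ', MulAut.mul_apply, pow_mul, hu3, hu1 x hx, MulAut.one_apply] at h1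
  rw [← QuotientGroup.eq_one_iff, QuotientGroup.mk_mul, ← h1, mul_inv_cancel]

end ProP

/-! ### Quotients of `F_n` -/

section Quotients

variable {p n : ℕ} [Fact p.Prime]

/-- An involution descends along an equivariant surjection. -/
theorem FreeProP.exists_sigmaAction {G : Type*} [Group G] [TopologicalSpace G] [T2Space G]
    (π : FreeProP p n →ₜ* G) (hπ : Function.Surjective π)
    (h : ∀ x, π x = 1 → π ((sigma p n).sigma x) = 1) :
    ∃ s : SigmaAction G, ∀ y, π ((sigma p n).sigma y) = s.sigma (π y) := by
  obtain ⟨f, hf⟩ : ∃ f : G → G, ∀ y, f (π y) = π ((sigma p n).sigma y) := by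
    refine ⟨fun g => π ((sigma p n).sigma (Function.surjInv hπ g)), fun y => ?_⟩
    have h1 := h ((Function.surjInv hπ (π y))⁻¹ * y) (by
      rw [map_mul, map_inv, Function.surjInv_eq hπ, inv_mul_cancel])
    rw [map_mul, map_inv, map_mul, map_inv] at h1
    exact inv_mul_eq_one.1 h1
  have hff : ∀ g, f (f g) = g := by
    intro g
    obtain ⟨y, rfl⟩ := hπ g
    rw [hf, hf, (sigma p n).sigma_sigma]
  have hc : Continuous f := by
    refine (isQuotientMap_of_surjective π hπ).continuous_iff.2 ?_
    exact (π.continuous_toFun.comp (sigma p n).sigma.continuous_toFun).congr fun y => (hf y).symm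
  refine ⟨⟨{ toFun := f, invFun := f, left_inv := hff, right_inv := hff,
             map_mul' := fun g h => ?_, continuous_toFun := hc, continuous_invFun := hc }, hff⟩,
    fun y => (hf y).symm⟩
  obtain ⟨x, rfl⟩ := hπ g
  obtain ⟨y, rfl⟩ := hπ h
  rw [← map_mul, hf, hf, hf, map_mul, map_mul]

theorem FreeProP.generates_odd {G : Type*} [Group G] [TopologicalSpace G] [IsTopologicalGroup G]
    (π : FreeProP p n →ₜ* G) (hπ : Function.Surjective π) (s : SigmaAction G)
    (h : ∀ y, π ((sigma p n).sigma y) = s.sigma (π y)) : TopologicallyGenerates s.odd := by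
  refine top_le_iff.1 ((generates_of_surjective hπ).ge.trans
    (closure_mono (Subgroup.closure_mono ?_)))
  rintro _ ⟨i, rfl⟩
  change s.sigma (π (gen p n i)) = (π (gen p n i))⁻¹
  rw [← h, sigma_gen, map_inv]

/-- The surjection from `F_n` to a group isomorphic to `G ⧸ D(G)`. -/
theorem exists_quotient_map (D : Subgroup (FreeProP p n)) [IsTopCharacteristic D]
    (hD : IsOpen (D : Set (FreeProP p n))) {G : Type*} [Group G]
    [TopologicalSpace G] [IsTopologicalGroup G] [T2Space G] (φ : FreeProP p n →ₜ* G)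
    (hφ : Function.Surjective φ) (hker : InFrattini p (φ : FreeProP p n →* G).ker)
    {H : Type*} [Group H] [TopologicalSpace H] [DiscreteTopology H]
    (e : G ⧸ canonicalSubgroup D G ≃* H) :
    ∃ ψ : FreeProP p n →ₜ* H, Function.Surjective ψ ∧
      (ψ : FreeProP p n →* H).ker = (φ : FreeProP p n →* G).ker ⊔ D := by
  let f : FreeProP p n →* H := (e.toMonoidHom.comp (QuotientGroup.mk' _)).comp φ
  have hker' : f.ker = (φ : FreeProP p n →* G).ker ⊔ D := by
    ext x
    have h1 : x ∈ f.ker ↔ φ x ∈ canonicalSubgroup D G := by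
      rw [MonoidHom.mem_ker]
      change e (QuotientGroup.mk (φ x)) = 1 ↔ _
      rw [map_eq_one_iff e e.injective, QuotientGroup.eq_one_iff]
    rw [h1, canonicalSubgroup_eq_map D φ hφ hker]
    constructor
    · rintro ⟨d, hd, hdx⟩
      have h2 : x * d⁻¹ ∈ (φ : FreeProP p n →* G).ker := by
        change φ (x * d⁻¹) = 1
        rw [map_mul, map_inv, mul_inv_eq_one]
        exact hdx.symm
      rw [← inv_mul_cancel_right x d]
      exact Subgroup.mul_mem_sup h2 hd
    · intro hx
      obtain ⟨a, ha, d, hd, rfl⟩ := Subgroup.mem_sup_of_normal_right.1 hx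
      refine ⟨d, hd, ?_⟩
      change φ d = φ (a * d)
      rw [map_mul, show φ a = 1 from ha, one_mul]
  have hc : Continuous f := by
    refine continuous_of_continuousAt_one f ?_
    rw [ContinuousAt, map_one]
    refine tendsto_const_nhds.congr' ?_
    filter_upwards [hD.mem_nhds D.one_mem] with x hx
    have : x ∈ f.ker := hker' ▸ Subgroup.mem_sup_right hx
    exact this.symm
  refine ⟨{ f with continuous_toFun := hc }, fun h => ?_, hker'⟩
  obtain ⟨g, hg⟩ := QuotientGroup.mk_surjective (e.symm h)
  obtain ⟨x, rfl⟩ := hφ g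
  refine ⟨x, ?_⟩
  change e (QuotientGroup.mk (φ x)) = h
  rw [hg, e.apply_symm_apply]

/-- The quotient of `F_n` by `n` odd relations in the Frattini subgroup is a weak Schur
`σ`-group. -/
theorem FreeProP.exists_isWeakSchur (r : Fin n → FreeProP p n)
    (hodd : ∀ i, (sigma p n).sigma (r i) = (r i)⁻¹)
    (R : Subgroup (FreeProP p n)) [R.Normal] (hRc : IsClosed (R : Set (FreeProP p n)))
    (hfr : InFrattini p R) (hrR : ∀ i, r i ∈ R)
    (hmin : ∀ A : Subgroup (FreeProP p n), A.Normal → IsClosed (A : Set (FreeProP p n)) →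
      (∀ i, r i ∈ A) → R ≤ A) :
    ∃ s : SigmaAction (FreeProP p n ⧸ R),
      IsWeakSchur p s ∧ HasMinGenerators (FreeProP p n ⧸ R) n := by
  have hG : IsProP p (FreeProP p n ⧸ R) := (isProP p n).quotient R hRc
  have := hG.t2
  let π : FreeProP p n →ₜ* FreeProP p n ⧸ R :=
    { QuotientGroup.mk' R with continuous_toFun := QuotientGroup.continuous_mk }
  have hπ : Function.Surjective π := QuotientGroup.mk_surjective
  have hkerR : (π : FreeProP p n →* FreeProP p n ⧸ R).ker = R := QuotientGroup.ker_mk' R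
  -- The preimage of R under σ is closed, normal and contains the r_i, so minimality of R applies.
  have hσR : R ≤ R.comap ((sigma p n).sigma.toMulEquiv : FreeProP p n →* FreeProP p n) := by
    refine hmin _ inferInstance (hRc.preimage (sigma p n).sigma.continuous_toFun) fun i => ?_
    change (sigma p n).sigma (r i) ∈ R
    rw [hodd]
    exact R.inv_mem (hrR i)
  obtain ⟨s, hs⟩ := exists_sigmaAction π hπ fun x hx =>
    (QuotientGroup.eq_one_iff _).2 (hσR ((QuotientGroup.eq_one_iff x).1 hx))
  have hker : InFrattini p (π : FreeProP p n →* FreeProP p n ⧸ R).ker := hkerR.symm ▸ hfr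
  have hr1 : ∀ i, π (r i) = 1 := fun i => (QuotientGroup.eq_one_iff _).2 (hrR i)
  have hgen : ∀ A : Subgroup (FreeProP p n), A.Normal → IsClosed (A : Set (FreeProP p n)) →
      (∀ i, r i ∈ A) → (π : FreeProP p n →* FreeProP p n ⧸ R).ker ≤ A := hkerR.symm ▸ hmin
  have hle := le_rank_contH1 π hπ hker
  have hgens := generates_of_surjective hπ
  refine ⟨s, ⟨hG, (rank_contH2_le π hker r hr1 hπ hgen).trans hle,
    (rank_contH1_le hgens).trans_lt (Cardinal.natCast_lt_aleph0), fun χ hχ => ?_,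
    contH2Map_eq_neg π hker r hr1 hπ hgen s hs hodd⟩, ⟨_, hgens⟩, ?_⟩
  · exact s.contH1_comp_sigma (generates_odd π hπ s hs) hχ
  · rintro k ⟨x, hx⟩
    exact_mod_cast hle.trans (rank_contH1_le hx)

end Quotients

/-! ### Odd relations and the proof of the proposition. -/

section Main

variable {p n : ℕ} [Fact p.Prime]

theorem rank_relationModule_le_of_le {D E N M : Subgroup (FreeProP p n)} [D.Normal] [E.Normal]
    [N.Normal] [M.Normal] (hED : E ≤ D) (hNM : N ≤ M) (h : M ≤ N ⊔ D) :
    Module.rank (ZMod p) (RelationModule p D M) ≤ Module.rank (ZMod p) (RelationModule p E N) :=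
  LinearMap.rank_le_of_surjective _ (RelationModule.map_surjective
    (ContinuousMonoidHom.id (FreeProP p n)) hED hNM
    (h.trans (sup_le_sup_right (fun x hx => ⟨x, hx, rfl⟩) _)))

/-- If `σ` acts by `-1` on `N ⧸ E N^*`, then `N` is generated modulo `E` by `dim N ⧸ E N^*`
odd relations. -/
theorem FreeProP.exists_odd_relations (hp : Odd p) {E N : Subgroup (FreeProP p n)} [E.Normal]
    [N.Normal] (hE : IsOpen (E : Set (FreeProP p n)))
    (hσN : ∀ x ∈ N, (sigma p n).sigma x ∈ N)
    (hodd : ∀ x ∈ N, (sigma p n).sigma x * x ∈ E ⊔ relativeFrattini p N)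
    (hrank : Module.rank (ZMod p) (RelationModule p E N) = n) :
    ∃ r : Fin n → FreeProP p n, (∀ i, r i ∈ N) ∧ (∀ i, (sigma p n).sigma (r i) = (r i)⁻¹) ∧
      ∀ R : Subgroup (FreeProP p n), R.Normal → (∀ i, r i ∈ R) → N ≤ R ⊔ E := by
  have h2 : (2 : ZMod p) ≠ 0 := by
    intro h
    have h4 : p ∣ 2 := (ZMod.natCast_eq_zero_iff 2 p).1 (by exact_mod_cast h)
    rw [(Nat.prime_dvd_prime_iff_eq Fact.out Nat.prime_two).1 h4] at hp
    exact absurd hp (by decide)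
  have hfin := RelationModule.finite (p := p) hE N
  let b : Module.Basis (Fin n) (ZMod p) (RelationModule p E N) :=
    Module.finBasisOfFinrankEq _ _ (Module.finrank_eq_of_rank_eq hrank)
  choose y hy using fun i => RelationModule.mk_surjective (b i)
  -- These elements are odd by construction. Their classes are twice the basis vectors, hence again
  -- a basis since p is odd.
  have hr : ∀ i, (y i : FreeProP p n) * ((sigma p n).sigma (y i))⁻¹ ∈ N := fun i =>
    N.mul_mem (y i).2 (N.inv_mem (hσN _ (y i).2))
  have hmk : ∀ i, RelationModule.mk p E ⟨_, hr i⟩ = (2 : ZMod p) • b i := by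
    intro i
    have h1 : RelationModule.mk p E (⟨_, hσN _ (y i).2⟩ * y i) = 0 :=
      (RelationModule.mk_eq_zero _).2 (hodd _ (y i).2)
    have h3 : RelationModule.mk p E ⟨_, hr i⟩ =
        RelationModule.mk p E (y i * ⟨_, hσN _ (y i).2⟩⁻¹) := rfl
    rw [RelationModule.mk_mul, add_eq_zero_iff_eq_neg] at h1
    rw [h3, RelationModule.mk_mul, RelationModule.mk_inv, h1, neg_neg, hy, two_smul]
  refine ⟨_, hr, fun i => (sigma p n).mul_inv_sigma_mem_odd _, fun R hRn hrR => ?_⟩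
  have : (R ⊔ E).Normal := inferInstance
  -- Nakayama: it is enough that elements of R ∩ N span N/EN^*.
  refine (isProP p n).le_of_le_sup_relativeFrattini (M := R ⊔ E)
    (Subgroup.isOpen_mono le_sup_right hE) fun m hm => ?_
  have hspan : ∀ v ∈ Submodule.span (ZMod p) (Set.range b),
      ∃ x : N, (x : FreeProP p n) ∈ R ∧ RelationModule.mk p E x = v := by
    have hpow : ∀ (k : ℕ) (x : N), RelationModule.mk p E (x ^ k) = k • RelationModule.mk p E x :=
      fun _ _ => rfl
    have hsmul : ∀ (t : ZMod p) (v), (∃ x : N, (x : FreeProP p n) ∈ R ∧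
        RelationModule.mk p E x = v) →
        ∃ x : N, (x : FreeProP p n) ∈ R ∧ RelationModule.mk p E x = t • v := by
      rintro t _ ⟨x, hx, rfl⟩
      refine ⟨x ^ t.val, R.pow_mem hx _, ?_⟩
      rw [hpow, ← Nat.cast_smul_eq_nsmul (ZMod p), ZMod.natCast_zmod_val]
    intro v hv
    induction hv using Submodule.span_induction with
    | mem v hv =>
      obtain ⟨i, rfl⟩ := hv
      have h3 := hsmul (2 : ZMod p)⁻¹ _ ⟨⟨_, hr i⟩, hrR i, hmk i⟩
      rwa [inv_smul_smul₀ h2] at h3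
    | zero => exact ⟨1, R.one_mem, rfl⟩
    | add v w _ _ hv hw =>
      obtain ⟨x, hx, rfl⟩ := hv
      obtain ⟨z, hz, rfl⟩ := hw
      exact ⟨x * z, R.mul_mem hx hz, rfl⟩
    | smul t v _ hv => exact hsmul t v hv
  obtain ⟨x, hx, hxm⟩ := hspan (RelationModule.mk p E ⟨m, hm⟩) (b.span_eq ▸ Submodule.mem_top)
  have h3 := (RelationModule.mk_eq_mk _ _).1 hxm
  rw [sup_assoc, ← mul_inv_cancel_left (x : FreeProP p n) m]
  exact Subgroup.mul_mem_sup hx h3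

/-- The involution acts by `-1` on the relation module of a Schur `D`-quotient, for any
`σ`-structure generated by odd elements. -/
theorem IsSchurQuotient.sigma_mul_mem (hp : Odd p) (D : Subgroup (FreeProP p n))
    [IsTopCharacteristic D] (hD_open : IsOpen (D : Set (FreeProP p n)))
    {H : Type*} [Group H] [TopologicalSpace H] [DiscreteTopology H]
    (hH : IsSchurQuotient D H) (ψ : FreeProP p n →ₜ* H) (hψ : Function.Surjective ψ)
    (hfr : InFrattini p (ψ : FreeProP p n →* H).ker)
    (hσ : ∀ x ∈ (ψ : FreeProP p n →* H).ker,
      (FreeProP.sigma p n).sigma x ∈ (ψ : FreeProP p n →* H).ker) :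
    ∀ x ∈ (ψ : FreeProP p n →* H).ker, (FreeProP.sigma p n).sigma x * x ∈
      D ⊔ relativeFrattini p (ψ : FreeProP p n →* H).ker := by
  obtain ⟨-, -, G, _, _, _, s, hG, hd, ⟨e⟩⟩ := hH
  have hT2 := hG.isProP.t2
  obtain ⟨x, hx⟩ := hd.1
  obtain ⟨π, hπ, hπs⟩ := SigmaAction.exists_equivariant hp hG.isProP s hG.odd_H1 x hx
  have hπfr := FreeProP.inFrattini_ker hG.isProP hd π hπ
  obtain ⟨ψ', hψ', hker'⟩ := exists_quotient_map D hD_open π hπ hπfr e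
  obtain ⟨α, hα⟩ := FreeProP.exists_equiv_comp inferInstance ψ ψ' hψ hψ' hfr
  have hα' : ∀ x, ψ' (α.symm x) = ψ x := fun x => by rw [← hα, α.apply_symm_apply]
  have key : ∀ m ∈ (ψ' : FreeProP p n →* H).ker, (FreeProP.sigma p n).sigma m * m ∈
      D ⊔ relativeFrattini p (ψ' : FreeProP p n →* H).ker := fun m hm =>
    hG.sigma_mul_mem π hπ hπfr hπs hD_open
      (fun x hx => IsTopCharacteristic.apply_mem D _ hx) (hker' ▸ le_sup_right)
      (hker' ▸ le_sup_left) hker'.le hm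
  have hσ' : ∀ x ∈ (ψ' : FreeProP p n →* H).ker,
      (FreeProP.sigma p n).sigma x ∈ (ψ' : FreeProP p n →* H).ker := by
    have hle : (π : FreeProP p n →* G).ker ⊔ D ≤ ((π : FreeProP p n →* G).ker ⊔ D).comap
        ((FreeProP.sigma p n).sigma.toMulEquiv : FreeProP p n →* FreeProP p n) := by
      refine sup_le (fun x hx => Subgroup.mem_sup_left ?_)
        fun x hx => Subgroup.mem_sup_right (IsTopCharacteristic.apply_mem D _ hx)
      change π ((FreeProP.sigma p n).sigma x) = 1
      rw [hπs, show π x = 1 from hx, map_one]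
    rw [hker']
    exact hle
  -- The weak Schur group controls σ relative to its own presentation ψ'. Transported along α, this
  -- says that t = ασα⁻¹ inverts ker ψ modulo D(ker ψ)^*; comparing t with σ gives the claim.
  let t : SigmaAction (FreeProP p n) :=
    { sigma := α.symm.trans ((FreeProP.sigma p n).sigma.trans α)
      sigma_sigma := fun x => by
        change α ((FreeProP.sigma p n).sigma (α.symm (α ((FreeProP.sigma p n).sigma
          (α.symm x))))) = x
        rw [α.symm_apply_apply, SigmaAction.sigma_sigma, α.apply_symm_apply] }
  have ht : ∀ x, t.sigma x = α ((FreeProP.sigma p n).sigma (α.symm x)) := fun _ => rfl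
  have hL := fun (β : FreeProP p n ≃ₜ* FreeProP p n)
    (hβ : ∀ x ∈ (ψ : FreeProP p n →* H).ker, β x ∈ (ψ : FreeProP p n →* H).ker) =>
    sup_relativeFrattini_le_comap (p := p) (E := D) (E' := D)
      (N := (ψ : FreeProP p n →* H).ker) (N' := (ψ : FreeProP p n →* H).ker)
      (β : FreeProP p n →ₜ* FreeProP p n)
      (fun x hx => IsTopCharacteristic.apply_mem D β hx) hβ
  refine (FreeProP.isProP p n).involution_mul_mem hp
    (Subgroup.isOpen_mono le_sup_left hD_open) (FreeProP.sigma p n) t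
    (fun χ hχ x => FreeProP.contH1_sigma hχ x) (fun χ hχ x => ?_) (fun x hx => hL _ hσ hx)
    (fun x hx => hL t.sigma (fun y hy => ?_) hx) hσ fun x hx => ?_
  · have h1 := FreeProP.contH1_sigma (contH1.comp_mem hχ (α : FreeProP p n →ₜ* FreeProP p n))
      (α.symm x)
    rw [ht]
    refine h1.trans ?_
    change -χ (α (α.symm x)) = _
    rw [α.apply_symm_apply]
  · change ψ (t.sigma y) = 1
    rw [ht, hα]
    exact hσ' _ ((hα' y).trans hy)
  · have h1 := key _ ((hα' x).trans hx)
    have h2 := sup_relativeFrattini_le_comap (p := p) (E := D) (E' := D)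
      (N := (ψ' : FreeProP p n →* H).ker) (N' := (ψ : FreeProP p n →* H).ker)
      (α : FreeProP p n →ₜ* FreeProP p n)
      (fun x hx => IsTopCharacteristic.apply_mem D α hx) (fun x hx => (hα x).trans hx) h1
    change α ((FreeProP.sigma p n).sigma (α.symm x) * α.symm x) ∈
      D ⊔ relativeFrattini p (ψ : FreeProP p n →* H).ker at h2
    rwa [map_mul, α.apply_symm_apply] at h2

end Main

theorem mainTheorem6 (p : ℕ) [Fact p.Prime] (hp : Odd p) (n : ℕ)
    (E D : Subgroup (FreeProP p n)) [IsTopCharacteristic E] [IsTopCharacteristic D]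
    (hE_open : IsOpen (E : Set (FreeProP p n))) (hE_proper : E ≠ ⊤)
    (hD_open : IsOpen (D : Set (FreeProP p n))) (hD_proper : D ≠ ⊤)
    (hED : E ≤ D)
    (H : Type*) [Group H] [TopologicalSpace H] [DiscreteTopology H]
    (hH : IsSchurQuotient D H) (hrH : relationRank D H = (n : Cardinal))
    (K : Type*) [Group K] [TopologicalSpace K] [DiscreteTopology K]
    [Finite K] (hK : IsPGroup p K) (hdK : HasMinGenerators K n)
    (hKH : Nonempty (K ⧸ canonicalSubgroup D K ≃* H)) :
    IsSchurQuotient E K ↔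
      canonicalSubgroup E K = ⊥ ∧
      (∃ s : SigmaAction K, TopologicallyGenerates s.odd) ∧
      relationRank E K = (n : Cardinal) := by
  have hEfr := FreeProP.inFrattini_of_isTopCharacteristic E
    (Subgroup.isClosed_of_isOpen _ hE_open) hE_proper
  have hDfr := FreeProP.inFrattini_of_isTopCharacteristic D
    (Subgroup.isClosed_of_isOpen _ hD_open) hD_proper
  have hKP := IsProP.of_isPGroup hK
  obtain ⟨eH⟩ := hKH
  constructor
  · rintro ⟨-, -, G, _, _, _, s, hG, hd, ⟨e⟩⟩
    have hT2 := hG.isProP.t2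
    obtain ⟨x, hx⟩ := hd.1
    obtain ⟨π, hπ, hπs⟩ := SigmaAction.exists_equivariant hp hG.isProP s hG.odd_H1 x hx
    have hπfr := FreeProP.inFrattini_ker hG.isProP hd π hπ
    obtain ⟨φ, hφ, hker⟩ := exists_quotient_map E hE_open π hπ hπfr e
    have hφfr : InFrattini p (φ : FreeProP p n →* K).ker := hker ▸ hπfr.sup hEfr
    have hEφ : E ≤ (φ : FreeProP p n →* K).ker := hker ▸ le_sup_right
    obtain ⟨ψ, hψ, hkerψ⟩ := exists_quotient_map D hD_open φ hφ hφfr eH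
    have hψfr : InFrattini p (ψ : FreeProP p n →* H).ker := hkerψ ▸ hφfr.sup hDfr
    refine ⟨?_, ?_, ?_⟩
    · rwa [canonicalSubgroup_eq_map E φ hφ hφfr, Subgroup.map_eq_bot_iff]
    · have hle : (π : FreeProP p n →* G).ker ⊔ E ≤ ((π : FreeProP p n →* G).ker ⊔ E).comap
          ((FreeProP.sigma p n).sigma.toMulEquiv : FreeProP p n →* FreeProP p n) := by
        refine sup_le (fun x hx => Subgroup.mem_sup_left ?_)
          fun x hx => Subgroup.mem_sup_right (IsTopCharacteristic.apply_mem E _ hx)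
        change π ((FreeProP.sigma p n).sigma x) = 1
        rw [hπs, show π x = 1 from hx, map_one]
      rw [← hker] at hle
      obtain ⟨sK, hsK⟩ := FreeProP.exists_sigmaAction φ hφ fun x hx => hle hx
      exact ⟨sK, FreeProP.generates_odd φ hφ sK hsK⟩
    · rw [relationRank_eq E φ hφ hφfr]
      -- The upper bound comes from H²(G), the lower one from the surjection onto the relation
      -- module of H, of dimension n.
      refine le_antisymm (hG.rank_relationModule_le π hπ hπfr hE_open hEφ
        (hker ▸ le_sup_left) hker.le) ?_
      rw [← hrH, relationRank_eq D ψ hψ hψfr]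
      exact rank_relationModule_le_of_le hED (hkerψ ▸ le_sup_left) hkerψ.le
  · rintro ⟨ha, ⟨s, hs⟩, hc⟩
    obtain ⟨x, hx⟩ := hdK.1
    obtain ⟨φ, hφ, hφs⟩ := SigmaAction.exists_equivariant hp hKP s
      (fun χ hχ => s.contH1_comp_sigma hs hχ) x hx
    have hφfr := FreeProP.inFrattini_ker hKP hdK φ hφ
    rw [canonicalSubgroup_eq_map E φ hφ hφfr, Subgroup.map_eq_bot_iff] at ha
    rw [relationRank_eq E φ hφ hφfr] at hc
    obtain ⟨ψ, hψ, hkerψ⟩ := exists_quotient_map D hD_open φ hφ hφfr eH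
    have hψfr : InFrattini p (ψ : FreeProP p n →* H).ker := hkerψ ▸ hφfr.sup hDfr
    rw [relationRank_eq D ψ hψ hψfr] at hrH
    have hσφ : ∀ x ∈ (φ : FreeProP p n →* K).ker,
        (FreeProP.sigma p n).sigma x ∈ (φ : FreeProP p n →* K).ker := by
      intro x hx
      change φ ((FreeProP.sigma p n).sigma x) = 1
      rw [hφs, show φ x = 1 from hx, map_one]
    have hσψ : (ψ : FreeProP p n →* H).ker ≤ (ψ : FreeProP p n →* H).ker.comap
        ((FreeProP.sigma p n).sigma.toMulEquiv : FreeProP p n →* FreeProP p n) := by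
      rw [hkerψ]
      exact sup_le (fun x hx => Subgroup.mem_sup_left (hσφ x hx))
        fun x hx => Subgroup.mem_sup_right (IsTopCharacteristic.apply_mem D _ hx)
    have hφψ : (φ : FreeProP p n →* K).ker ≤ (ψ : FreeProP p n →* H).ker := hkerψ ▸ le_sup_left
    have hoddD := hH.sigma_mul_mem hp D hD_open ψ hψ hψfr hσψ
    have hfinE := RelationModule.finite (p := p) hE_open (φ : FreeProP p n →* K).ker
    have hfinD := RelationModule.finite (p := p) hD_open (ψ : FreeProP p n →* H).ker
    -- Here the equality r_E(K) = n = r_D(H) enters: injectivity lets the sign -1 be pulled back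
    -- from the relation module of H.
    have hinj := (LinearMap.injective_iff_surjective_of_finrank_eq_finrank
      ((Module.finrank_eq_of_rank_eq hc).trans (Module.finrank_eq_of_rank_eq hrH).symm)).2
      (RelationModule.map_surjective (p := p) (ContinuousMonoidHom.id (FreeProP p n)) hED hφψ
        (hkerψ.le.trans (sup_le_sup_right (fun x hx => ⟨x, hx, rfl⟩) _)))
    have hoddE : ∀ x ∈ (φ : FreeProP p n →* K).ker, (FreeProP.sigma p n).sigma x * x ∈
        E ⊔ relativeFrattini p (φ : FreeProP p n →* K).ker := by
      intro x hx
      refine (RelationModule.mk_eq_zero ⟨_, mul_mem (hσφ x hx) hx⟩).1 (hinj ?_)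
      rw [map_zero]
      exact (RelationModule.mk_eq_zero _).2 (hoddD x (hφψ hx))
    obtain ⟨r, hrN, hrodd, hrgen⟩ := FreeProP.exists_odd_relations hp hE_open hσφ hoddE hc
    let R := (Subgroup.normalClosure (Set.range r)).topologicalClosure
    have hRn : R.Normal := Subgroup.is_normal_topologicalClosure _
    have hRc : IsClosed (R : Set (FreeProP p n)) := Subgroup.isClosed_topologicalClosure _
    have hrR : ∀ i, r i ∈ R := fun i =>
      Subgroup.le_topologicalClosure _ (Subgroup.subset_normalClosure ⟨i, rfl⟩)
    have hmin : ∀ A : Subgroup (FreeProP p n), A.Normal → IsClosed (A : Set (FreeProP p n)) →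
        (∀ i, r i ∈ A) → R ≤ A := fun A _ hA h =>
      Subgroup.topologicalClosure_minimal _ (Subgroup.normalClosure_le_normal (by
        rintro _ ⟨i, rfl⟩; exact h i)) hA
    have hRN : R ≤ (φ : FreeProP p n →* K).ker := hmin _ inferInstance
      (isClosed_singleton.preimage φ.continuous_toFun) hrN
    have hRfr : InFrattini p R := hφfr.mono hRN
    obtain ⟨sG, hG, hd⟩ := FreeProP.exists_isWeakSchur r hrodd R hRc hRfr hrR hmin
    refine ⟨inferInstance, hK, FreeProP p n ⧸ R, inferInstance, inferInstance, inferInstance, sG,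
      hG, hd, ?_⟩
    let f : FreeProP p n ⧸ R →* K := QuotientGroup.lift R φ hRN
    have hf : Function.Surjective f := fun k => by
      obtain ⟨x, rfl⟩ := hφ k
      exact ⟨QuotientGroup.mk x, rfl⟩
    have hT2 := hG.isProP.t2
    -- For N = ker φ, this amounts to RE = N: one inclusion is E(K) = 1 together with R ≤ N, the
    -- other is the choice of the r_i.
    have hcan : canonicalSubgroup E (FreeProP p n ⧸ R) = f.ker := by
      rw [canonicalSubgroup_eq_map E (G := FreeProP p n ⧸ R)
        { QuotientGroup.mk' R with continuous_toFun := QuotientGroup.continuous_mk }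
        QuotientGroup.mk_surjective (fun χ hχ x hx => hRfr χ hχ x
          ((QuotientGroup.eq_one_iff x).1 hx))]
      refine le_antisymm ?_ fun y hy => ?_
      · rintro _ ⟨x, hx, rfl⟩
        exact ha hx
      · obtain ⟨x, rfl⟩ := QuotientGroup.mk_surjective y
        obtain ⟨a, ha', b, hb, rfl⟩ := Subgroup.mem_sup_of_normal_right.1
          (hrgen R hRn hrR (show x ∈ (φ : FreeProP p n →* K).ker from hy))
        refine ⟨b, hb, ?_⟩
        change (QuotientGroup.mk b : FreeProP p n ⧸ R) = QuotientGroup.mk (a * b)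
        rw [QuotientGroup.mk_mul, (QuotientGroup.eq_one_iff a).2 ha', one_mul]
    exact ⟨(QuotientGroup.quotientMulEquivOfEq hcan).trans
      (QuotientGroup.quotientKerEquivOfSurjective f hf)⟩
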